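/- Let $k_\gamma,k_v,k_w$ be fixed. For every pair of sample sizes $(N,T)$ let there be given a probability space (everything may vary with $(N,T)$, which is suppressed in the notation), a sub-sigma-algebra $\mathcal F$ of common events, random vectors $v_s\in\mathbb R^{k_v}$ and $w_{st}\in\mathbb R^{k_w}$ ($1\le s,t\le T$), random error vectors $e_t=(e_{1t},\dots,e_{Nt})'$ ($1\le t\le T$), and non-random weights $\gamma_i\in\mathbb R^{k_\gamma}$ ($1\le i\le N$); let $\gamma$ be the $N\times k_\gamma$ matrix with rows $\gamma_i'$. Write $\|\cdot\|$ for the Euclidean norm of a vector and the operator norm of a matrix, $\max\mathrm{ev}$ for the largest eigenvalue, and $\mathrm{dg}(A)$ for the diagonal part of $A$. All limits are as $N,T\to\infty$ jointly, without restriction on the rates, and each $C$ is a constant independent of $N$ and $T$. Put $$\xi_i=\begin{pmatrix}\frac1{\sqrt T}\sum_{s=1}^T(\gamma_i\otimes v_s)\,e_{is}\\[2pt] \frac1T\sum_{s=1}^T\sum_{t<s}w_{st}\,e_{it}e_{is}\end{pmatrix}.$$ Assume the following. (1) Common variables: $v_s$ and $w_{st}$ are $\mathcal F$-measurable; $\frac1T\sum_{s}\mathbb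 E(v_sv_s')\to\Omega_v$ and $\frac1{T^2}\sum_{s}\sum_{t<s}\mathbb E(w_{st}w_{st}')\to\Omega_w$ with $\Omega_v,\Omega_w$ of full rank; $\max_s\mathbb E\|v_s\|^4<C$ and $\max_{s,t}\mathbb E\|w_{st}\|^4<C$; $\mathbb E\big\|\frac1{T^2}\sum_s\sum_{t<s}(w_{st}w_{st}'-\mathbb E w_{st}w_{st}')\big\|^2\to0$ and $\mathbb E\big\|\frac1T\sum_s(v_sv_s'-\mathbb E v_sv_s')\big\|^2\to0$. (2) Weights: $\max_{1\le i\le N}\|\gamma_i\|<C$. (3) Errors: conditionally on $\mathcal F$ the vectors $e_1,\dots,e_T$ are independent, and $\mathbb E(e_t\mid\mathcal F)=0$ for all $t$; $\max_{i,t}\mathbb E(e_{it}^4)<C$. (4) Independence from the common variables: $(e_1,\dots,e_T)$ is independent of $\mathcal F$, and the $e_t$ are identically distributed over $t$; the covariance matrix $\mathcal E_{N,T}=\mathbb E[e_te_t']$ satisfies $\limsup\max\mathrm{ev}(\mathcal E_{N,T})<\infty$ and $\frac1N\mathrm{tr}(\mathcal E_{N,T}^2)\to a$; $\frac1N\gamma'\mathcal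 E_{N,T}\gamma\to\Gamma_\sigma$ with $\Gamma_\sigma$ of full rank; and $\frac1{N^2}\sum_{i_1,i_2,i_3,i_4=1}^N|\mathbb E(e_{i_1t}e_{i_2t}e_{i_3t}e_{i_4t})|<C$. If in addition $\|\mathcal E_{N,T}-\mathrm{dg}(\mathcal E_{N,T})\|\to0$, then $$\frac1N\sum_{i=1}^N\xi_i\xi_i'\ \xrightarrow{\ p\ }\ \Sigma_\xi=\begin{pmatrix}\Gamma_\sigma\otimes\Omega_v&0\\0&a\,\Omega_w\end{pmatrix}.$$ -/

import Mathlib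

open MeasureTheory ProbabilityTheory Filter Topology
open scoped ENNReal NNReal
-- matrices carry the operator norm induced by the Euclidean norms
open scoped Matrix.Norms.L2Operator

namespace FactorPanel

universe u

noncomputable section

/-- The outer product `x x'` of a vector with itself. -/
def outer {ι : Type*} (x : EuclideanSpace ℝ ι) : Matrix ι ι ℝ :=
  Matrix.of fun a b => x a * x b

/-- The matrix `E(X X')` of second moments of a random vector `X`. -/
def secondMoment {Ω : Type*} [MeasurableSpace Ω] {ι : Type*} (μ : Measure Ω)
    (X : Ω → EuclideanSpace ℝ ι) : Matrix ι ι ℝ :=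
  Matrix.of fun a b => ∫ ω, X ω a * X ω b ∂μ

/-- The diagonal part `dg(A)` of a square matrix. -/
def dg {ι : Type*} [DecidableEq ι] (A : Matrix ι ι ℝ) : Matrix ι ι ℝ :=
  Matrix.diagonal A.diag

/-- The largest real eigenvalue of a square matrix. It is used for symmetric matrices of
positive size, whose spectrum is finite and non-empty. -/
def maxEv {ι : Type*} [Fintype ι] [DecidableEq ι] (A : Matrix ι ι ℝ) : ℝ :=
  sSup (spectrum ℝ A)

/-- The family `X` is (mutually) independent conditionally on the sigma-algebra `m`: the conditional
probability of every finite intersection of events `{X t ∈ A t}` is almost surely the product of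
their conditional probabilities. -/
def CondIndependent {Ω ι E : Type*} [MeasurableSpace E] (m : MeasurableSpace Ω)
    {mΩ : MeasurableSpace Ω} (μ : Measure[mΩ] Ω) (X : ι → Ω → E) : Prop :=
  ∀ (S : Finset ι) (A : ι → Set E), (∀ t ∈ S, MeasurableSet (A t)) →
    μ⟦⋂ t ∈ S, X t ⁻¹' A t | m⟧ =ᵐ[μ] ∏ t ∈ S, μ⟦X t ⁻¹' A t | m⟧

/-- The data-generating process for one pair of sample sizes `(N, T)`. The time indices `1, …, T`
are modelled by `Fin T`, the units `1, …, N` by `Fin N`. -/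
structure Model (kγ kv kw N T : ℕ) where
  /-- the probability space, with its sigma-algebra and probability -/
  Ω : Type u
  mΩ : MeasurableSpace Ω
  P : Measure[mΩ] Ω
  isProb : @IsProbabilityMeasure Ω mΩ P
  /-- the sigma-algebra of common events -/
  F : MeasurableSpace Ω
  F_le : F ≤ mΩ
  /-- the common variables `v_s` -/
  v : Fin T → Ω → EuclideanSpace ℝ (Fin kv)
  /-- the common variables `w_{st}` -/
  w : Fin T → Fin T → Ω → EuclideanSpace ℝ (Fin kw)
  /-- the error vectors `e_t = (e_{1t}, …, e_{Nt})'` -/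
  e : Fin T → Ω → EuclideanSpace ℝ (Fin N)
  measurable_e : ∀ t, Measurable[mΩ] (e t)
  /-- the non-random weights `γ_i` -/
  γ : Fin N → EuclideanSpace ℝ (Fin kγ)

attribute [instance] Model.mΩ Model.isProb

namespace Model

variable {kγ kv kw N T : ℕ} (M : Model.{u} kγ kv kw N T)

/-- The `N × kγ` matrix `γ` with rows `γ_i'`. -/
def gammaMatrix : Matrix (Fin N) (Fin kγ) ℝ := Matrix.of fun i a => M.γ i a

/-- The error covariance matrix `E[e_t e_t']`. It is only used when the `e_t` are identically
distributed, so that it does not depend on `t`; it is computed at the first period. -/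
def errorCov : Matrix (Fin N) (Fin N) ℝ :=
  if h : 0 < T then secondMoment M.P (M.e ⟨0, h⟩) else 0

/-- The linear component `T^{-1/2} ∑_s (γ_i ⊗ v_s) e_{is}` of `ξ_i`. -/
def xiV (i : Fin N) (ω : M.Ω) : Fin kγ × Fin kv → ℝ :=
  fun p => 1 / √(T : ℝ) * ∑ s, M.γ i p.1 * M.v s ω p.2 * M.e s ω i

/-- The quadratic component `T^{-1} ∑_s ∑_{t < s} w_{st} e_{it} e_{is}` of `ξ_i`. -/
def xiW (i : Fin N) (ω : M.Ω) : Fin kw → ℝ :=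
  fun c => 1 / (T : ℝ) * ∑ s, ∑ t ∈ Finset.Iio s, M.w s t ω c * M.e t ω i * M.e s ω i

/-- The stacked vector `ξ_i`. -/
def xi (i : Fin N) (ω : M.Ω) : (Fin kγ × Fin kv) ⊕ Fin kw → ℝ :=
  Sum.elim (M.xiV i ω) (M.xiW i ω)

/-- The naive variance estimator `N^{-1} ∑_i ξ_i ξ_i'`. -/
def varEstimator (ω : M.Ω) :
    Matrix ((Fin kγ × Fin kv) ⊕ Fin kw) ((Fin kγ × Fin kv) ⊕ Fin kw) ℝ :=
  (1 / (N : ℝ)) • ∑ i, Matrix.vecMulVec (M.xi i ω) (M.xi i ω)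

end Model

/-- A data-generating process for every pair of sample sizes. Limits as `N, T → ∞` are limits along
the filter `atTop` of `ℕ × ℕ`: both sizes grow, with no restriction on their rates. -/
abbrev PanelArray (kγ kv kw : ℕ) := ∀ p : ℕ × ℕ, Model.{u} kγ kv kw p.1 p.2

variable {kγ kv kw : ℕ}

/-- Assumptions on the common variables. -/
structure CommonVars (M : PanelArray.{u} kγ kv kw)
    (Ωv : Matrix (Fin kv) (Fin kv) ℝ) (Ωw : Matrix (Fin kw) (Fin kw) ℝ) : Prop where
  measurable_v : ∀ p s, Measurable[(M p).F] ((M p).v s)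
  measurable_w : ∀ p s t, Measurable[(M p).F] ((M p).w s t)
  tendsto_v : Tendsto (fun p => (1 / (p.2 : ℝ)) • ∑ s, secondMoment (M p).P ((M p).v s))
    atTop (𝓝 Ωv)
  tendsto_w : Tendsto (fun p => (1 / (p.2 : ℝ) ^ 2) •
      ∑ s, ∑ t ∈ Finset.Iio s, secondMoment (M p).P ((M p).w s t)) atTop (𝓝 Ωw)
  fullRank_v : Ωv.rank = kv
  fullRank_w : Ωw.rank = kw
  moment_v : ∃ C : ℝ≥0, ∀ p s, ∫⁻ ω, ‖(M p).v s ω‖ₑ ^ 4 ∂(M p).P ≤ C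
  moment_w : ∃ C : ℝ≥0, ∀ p s t, ∫⁻ ω, ‖(M p).w s t ω‖ₑ ^ 4 ∂(M p).P ≤ C
  lln_w : Tendsto (fun p => ∫⁻ ω, ‖(1 / (p.2 : ℝ) ^ 2) • ∑ s, ∑ t ∈ Finset.Iio s,
      (outer ((M p).w s t ω) - secondMoment (M p).P ((M p).w s t))‖ₑ ^ 2 ∂(M p).P) atTop (𝓝 0)
  lln_v : Tendsto (fun p => ∫⁻ ω, ‖(1 / (p.2 : ℝ)) • ∑ s,
      (outer ((M p).v s ω) - secondMoment (M p).P ((M p).v s))‖ₑ ^ 2 ∂(M p).P) atTop (𝓝 0)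

/-- The weights are uniformly bounded. -/
def Loadings (M : PanelArray.{u} kγ kv kw) : Prop :=
  ∃ C : ℝ, ∀ p i, ‖(M p).γ i‖ ≤ C

/-- Serial conditional independence, strict exogeneity, and fourth moments of the errors. -/
structure Errors (M : PanelArray.{u} kγ kv kw) : Prop where
  condIndep : ∀ p, CondIndependent (M p).F (M p).P (M p).e
  condExp_zero : ∀ p t, (M p).P[(M p).e t | (M p).F] =ᵐ[(M p).P] 0
  moment : ∃ C : ℝ≥0, ∀ p i t, ∫⁻ ω, ‖(M p).e t ω i‖ₑ ^ 4 ∂(M p).P ≤ C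

/-- Independence of the errors from the common variables, with weak cross-sectional dependence. -/
structure Independence (M : PanelArray.{u} kγ kv kw)
    (a : ℝ) (Γσ : Matrix (Fin kγ) (Fin kγ) ℝ) : Prop where
  indep : ∀ p, Indep (MeasurableSpace.comap (fun ω t => (M p).e t ω) inferInstance)
    (M p).F (M p).P
  identDistrib : ∀ p s t, IdentDistrib ((M p).e s) ((M p).e t) (M p).P (M p).P
  limsup_maxEv : limsup (fun p => ((maxEv (M p).errorCov : ℝ) : EReal)) atTop < ⊤
  tendsto_trace : Tendsto (fun p => 1 / (p.1 : ℝ) * ((M p).errorCov ^ 2).trace) atTop (𝓝 a)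
  tendsto_gamma : Tendsto (fun p => (1 / (p.1 : ℝ)) •
      ((M p).gammaMatrix.transpose * (M p).errorCov * (M p).gammaMatrix)) atTop (𝓝 Γσ)
  fullRank_gamma : Γσ.rank = kγ
  moment_sum : ∃ C : ℝ, ∀ p t, 1 / (p.1 : ℝ) ^ 2 * ∑ i₁, ∑ i₂, ∑ i₃, ∑ i₄,
      |∫ ω, (M p).e t ω i₁ * (M p).e t ω i₂ * (M p).e t ω i₃ * (M p).e t ω i₄ ∂(M p).P| ≤ C

/-- The limit `Σ_ξ`, block diagonal with blocks `Γσ ⊗ Ωv` and `a Ωw`. -/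
def sigmaXi (a : ℝ) (Γσ : Matrix (Fin kγ) (Fin kγ) ℝ) (Ωv : Matrix (Fin kv) (Fin kv) ℝ)
    (Ωw : Matrix (Fin kw) (Fin kw) ℝ) :
    Matrix ((Fin kγ × Fin kv) ⊕ Fin kw) ((Fin kγ × Fin kv) ⊕ Fin kw) ℝ :=
  Matrix.fromBlocks (Matrix.kronecker Γσ Ωv) 0 0 (a • Ωw)

/-- Convergence in probability, as `N, T → ∞`, of matrices that may live on different probability
spaces, to a constant matrix. -/
def TendstoInProb {ι : Type*} [Fintype ι] [DecidableEq ι] (M : PanelArray.{u} kγ kv kw)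
    (X : ∀ p, (M p).Ω → Matrix ι ι ℝ) (L : Matrix ι ι ℝ) : Prop :=
  ∀ ε : ℝ, 0 < ε → Tendsto (fun p => (M p).P {ω | ε ≤ ‖X p ω - L‖}) atTop (𝓝 0)

end

end FactorPanel

/-!
Write `ξ_i` componentwise as `scale · load_i · ∑_a coef_a ∏_{t ∈ a} e_{it}`, where `a` runs over
single periods for the linear components and over pairs of periods for the quadratic ones. An entry
of the estimator is then `∑_{a,b} c_{ab} K_{ab}`, with `c_{ab}` a product of two common variables
and `K_{ab} = N⁻¹ ∑_i g_i ∏_{t ∈ a} e_{it} ∏_{t ∈ b} e_{it}`, and it splits into the part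
`∑ c_{ab} E K_{ab}` and the deviation `∑ c_{ab} (K_{ab} - E K_{ab})`.

*Deviation.* Conditional independence together with independence from the common variables
makes the `e_t` independent (`iIndepFun_of_condIndependent`). The common variables factor out of the
second moment, so it is at most a constant times the normalised sum of `|Cov(K_{ab}, K_{a'b'})|`
(`IsErrorArray.integral_sq_sum_le_of_indep`). Let `k` be the number of error factors in `K_{ab}`, so
that the normalisation is `T ^ (-k)`. A covariance vanishes if some period occurs exactly once among
the `2k` factors; hence at most `k` periods occur. Quadruples with fewer than `k` periods number
`O(T ^ (k - 1))` (`card_le_of_card_union_le`) and have bounded covariances. If exactly `k` periods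
occur, each occurs twice. The covariance is zero without a period shared by the two monomials, and
with `r ≥ 1` shared periods it is `N⁻² ∑_{i,j} x_i y_j σ_{ij} ^ r` with bounded `x, y`. The operator
norm of the error covariance matrix bounds the case `r = 1` and its Frobenius norm the case `r ≥ 2`,
both at the order `1 / N` (`IsErrorArray.abs_sum_monomialCov_le_of_paired`). The deviation thus has
second moment `O(1 / T + 1 / N)` (`nullInProb_sub_meanPart`), whatever the relative rates.

*Mean part.* `E K_{ab}` vanishes unless `a = b`, when it is `N⁻¹ ∑_i g_i σ_{ii} ^ |a|`. So the
blocks mixing linear and quadratic components tend to zero, and in the diagonal blocks the laws of large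
numbers for the common variables apply. Since the off-diagonal part of the error covariance is
negligible in operator norm, `σ_{ii}` gives the same limits as the full matrix
(`tendsto_diag_gamma`, `tendsto_diag_sq`).
-/

set_option linter.unusedSectionVars false

namespace FactorPanel

universe u

/-! ### Counting tuples of sets with a small union -/

lemma exists_range_of_card_le {ι : Type*} [Nonempty ι] [DecidableEq ι] (s : Finset ι) {r : ℕ}
    (hs : s.card ≤ r) : ∃ u : Fin r → ι, ∀ x ∈ s, ∃ j, u j = x := by
  classical
  refine ⟨fun j => if h : (j : ℕ) < s.card then (s.equivFin.symm ⟨j, h⟩ : ι)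
    else Classical.arbitrary ι, fun x hx => ?_⟩
  refine ⟨Fin.castLE hs (s.equivFin ⟨x, hx⟩), ?_⟩
  simp

/-- A family of `n` sets whose union has at most `r` elements is the image of a family of `n`
subsets of `Fin r`, which leaves at most `|ι| ^ r * 2 ^ (r * n)` possibilities. -/
lemma card_le_of_card_union_le {ι X : Type*} [Fintype ι] [Nonempty ι] [DecidableEq ι]
    {n r : ℕ} (Q : Finset X) (τ : X → Fin n → Finset ι) (hτ : Set.InjOn τ Q)
    (hr : ∀ x ∈ Q, (Finset.univ.biUnion (τ x)).card ≤ r) :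
    Q.card ≤ Fintype.card ι ^ r * 2 ^ (r * n) := by
  classical
  have hu : ∀ x : X, ∃ u : Fin r → ι, x ∈ Q → ∀ y ∈ Finset.univ.biUnion (τ x), ∃ j, u j = y := by
    intro x
    by_cases hx : x ∈ Q
    · obtain ⟨u, hu⟩ := exists_range_of_card_le _ (hr x hx)
      exact ⟨u, fun _ => hu⟩
    · exact ⟨fun _ => Classical.arbitrary ι, fun h => absurd h hx⟩
  choose u hu using hu
  let F : X → (Fin r → ι) × (Fin n → Finset (Fin r)) :=
    fun x => (u x, fun j => Finset.univ.filter (fun y => u x y ∈ τ x j))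
  have hF : Set.InjOn F Q := by
    intro x hx y hy hxy
    apply hτ hx hy
    have h1 : u x = u y := congrArg Prod.fst hxy
    have h2 := congrArg Prod.snd hxy
    have key : ∀ z ∈ Q, ∀ j, τ z j = ((F z).2 j).image (F z).1 := by
      intro z hz j
      ext t
      simp only [F, Finset.mem_image, Finset.mem_filter, Finset.mem_univ, true_and]
      constructor
      · intro ht
        obtain ⟨i, hi⟩ := hu z hz t (Finset.mem_biUnion.2 ⟨j, Finset.mem_univ _, ht⟩)
        exact ⟨i, by rwa [hi], hi⟩
      · rintro ⟨i, hi, rfl⟩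
        exact hi
    funext j
    rw [key x hx, key y hy, hxy]
  have := Finset.card_le_card_of_injOn (t := Finset.univ) F (fun _ _ => Finset.mem_univ _) hF
  refine this.trans (le_of_eq ?_)
  simp [pow_mul]

/-! ### Bilinear forms of a matrix and its operator norm -/

section Matrix

variable {κ : Type*} [Fintype κ] [DecidableEq κ]

lemma abs_sum_sum_mul_le (A : Matrix κ κ ℝ) (x y : κ → ℝ) {X Y : ℝ} (hX : 0 ≤ X)
    (hx : ∀ i, |x i| ≤ X) (hy : ∀ i, |y i| ≤ Y) :
    |∑ i, ∑ j, x i * y j * A i j| ≤ Fintype.card κ * (X * Y * ‖A‖) := by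
  rcases isEmpty_or_nonempty κ with h | ⟨⟨i0⟩⟩
  · simp
  have hY : 0 ≤ Y := (abs_nonneg _).trans (hy i0)
  have norm_le : ∀ (z : κ → ℝ) (Z : ℝ), 0 ≤ Z → (∀ i, |z i| ≤ Z) →
      ‖(WithLp.toLp 2 z : EuclideanSpace ℝ κ)‖ ≤ √(Fintype.card κ) * Z := by
    intro z Z hZ hz
    rw [EuclideanSpace.norm_eq]
    refine Real.sqrt_le_iff.2 ⟨by positivity, ?_⟩
    rw [mul_pow, Real.sq_sqrt (by positivity)]
    calc ∑ i, ‖z i‖ ^ 2 ≤ ∑ _i : κ, Z ^ 2 := by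
          refine Finset.sum_le_sum fun i _ => ?_
          exact pow_le_pow_left₀ (norm_nonneg _) (hz i) 2
      _ = _ := by simp
  have h1 : ∑ i, ∑ j, x i * y j * A i j
      = inner ℝ (WithLp.toLp 2 x : EuclideanSpace ℝ κ) (WithLp.toLp 2 (A.mulVec y)) := by
    simp only [PiLp.inner_apply, Matrix.mulVec, dotProduct, RCLike.inner_apply, conj_trivial,
      Finset.sum_mul]
    refine Finset.sum_congr rfl fun i _ => Finset.sum_congr rfl fun j _ => by ring
  rw [h1]
  have h2 := Matrix.l2_opNorm_mulVec A (WithLp.toLp 2 y)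
  have h3 := abs_real_inner_le_norm (WithLp.toLp 2 x : EuclideanSpace ℝ κ)
    (WithLp.toLp 2 (A.mulVec y))
  have hs : √(Fintype.card κ : ℝ) * √(Fintype.card κ) = Fintype.card κ :=
    Real.mul_self_sqrt (by positivity)
  calc _ ≤ _ := h3
    _ ≤ (√(Fintype.card κ) * X) * (‖A‖ * (√(Fintype.card κ) * Y)) := by
        gcongr
        · exact norm_le x X hX hx
        · exact h2.trans (by gcongr; exact norm_le y Y hY hy)
    _ = (√(Fintype.card κ : ℝ) * √(Fintype.card κ)) * (X * Y * ‖A‖) := by ring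
    _ = _ := by rw [hs]

/-- The squared Frobenius norm is at most the size times the squared operator norm: each column is
the image of a unit vector. -/
lemma sum_sum_sq_le (A : Matrix κ κ ℝ) :
    ∑ i, ∑ j, A i j ^ 2 ≤ Fintype.card κ * ‖A‖ ^ 2 := by
  rw [Finset.sum_comm]
  calc ∑ j, ∑ i, A i j ^ 2 ≤ ∑ _j : κ, ‖A‖ ^ 2 := by
        refine Finset.sum_le_sum fun j _ => ?_
        have h := Matrix.l2_opNorm_mulVec A (EuclideanSpace.single j 1)
        rw [PiLp.norm_single, norm_one, mul_one] at h
        have h2 := pow_le_pow_left₀ (norm_nonneg _) h 2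
        rw [EuclideanSpace.norm_sq_eq] at h2
        simpa using h2
    _ = _ := by simp

lemma abs_entry_le_norm (A : Matrix κ κ ℝ) (i j : κ) : |A i j| ≤ ‖A‖ := by
  have h := Matrix.l2_opNorm_mulVec A (EuclideanSpace.single j 1)
  rw [PiLp.norm_single, norm_one, mul_one] at h
  have h2 := PiLp.norm_apply_le (WithLp.toLp 2 (A.mulVec (EuclideanSpace.single j (1 : ℝ)))) i
  simpa using h2.trans h

/-- The operator norm is dominated by a constant multiple of the sum of the absolute entries. -/
lemma norm_le_sum_abs_entries (A : Matrix κ κ ℝ) :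
    ‖A‖ ≤ ∑ i, ∑ j, |A i j| * ‖Matrix.single i j (1 : ℝ)‖ := by
  conv_lhs => rw [Matrix.matrix_eq_sum_single A]
  refine (norm_sum_le _ _).trans (Finset.sum_le_sum fun i _ => ?_)
  refine (norm_sum_le _ _).trans (Finset.sum_le_sum fun j _ => ?_)
  have : Matrix.single i j (A i j) = A i j • Matrix.single i j (1 : ℝ) := by simp
  rw [this, norm_smul, Real.norm_eq_abs]

end Matrix

/-! ### Mixed moments of a serially independent array of errors -/

/-- An array of centred errors that is independent over time, with a common covariance matrix `S`
and fourth moments bounded by `C`. -/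
structure IsErrorArray {Ω ι κ : Type*} [MeasurableSpace Ω] [Fintype κ] (P : Measure Ω)
    (e : ι → Ω → EuclideanSpace ℝ κ) (S : Matrix κ κ ℝ) (C : ℝ) : Prop where
  measurable : ∀ t, Measurable (e t)
  indep : iIndepFun e P
  mean_zero : ∀ t i, ∫ ω, e t ω i ∂P = 0
  integrable_fourth : ∀ t i, Integrable (fun ω => e t ω i ^ 4) P
  fourth_le : ∀ t i, ∫ ω, e t ω i ^ 4 ∂P ≤ C
  cov : ∀ t i j, ∫ ω, e t ω i * e t ω j ∂P = S i j

/-- The mixed moment `E(e_{it}^l e_{jt}^r)`. -/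
noncomputable def mixedMoment {Ω ι κ : Type*} [MeasurableSpace Ω] (P : Measure Ω)
    (e : ι → Ω → EuclideanSpace ℝ κ) (t : ι) (i j : κ) (l r : ℕ) : ℝ :=
  ∫ ω, e t ω i ^ l * e t ω j ^ r ∂P

/-- The monomial `∏_t e_{it}^{l_t}` in the errors of unit `i`. -/
noncomputable def monomial {Ω ι κ : Type*} [Fintype ι] (e : ι → Ω → EuclideanSpace ℝ κ)
    (l : ι → ℕ) (i : κ) (ω : Ω) : ℝ :=
  ∏ t, e t ω i ^ l t

lemma abs_pow_mul_pow_le {x y : ℝ} {l r : ℕ} (h : l + r ≤ 4) :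
    |x ^ l * y ^ r| ≤ 1 + x ^ 4 + y ^ 4 := by
  have h0 : 1 ≤ max 1 (max |x| |y|) := le_max_left _ _
  have h1 : |x| ≤ max 1 (max |x| |y|) := (le_max_left _ _).trans (le_max_right _ _)
  have h2 : |y| ≤ max 1 (max |x| |y|) := (le_max_right _ _).trans (le_max_right _ _)
  rw [abs_mul, abs_pow, abs_pow]
  calc |x| ^ l * |y| ^ r ≤ max 1 (max |x| |y|) ^ l * max 1 (max |x| |y|) ^ r := by gcongr
    _ = max 1 (max |x| |y|) ^ (l + r) := (pow_add _ _ _).symm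
    _ ≤ max 1 (max |x| |y|) ^ 4 := pow_le_pow_right₀ h0 h
    _ ≤ 1 + x ^ 4 + y ^ 4 := by
      have hx : |x| ^ 4 = x ^ 4 := by rw [← abs_pow, abs_of_nonneg (by positivity)]
      have hy : |y| ^ 4 = y ^ 4 := by rw [← abs_pow, abs_of_nonneg (by positivity)]
      have := pow_nonneg (abs_nonneg x) 4
      have := pow_nonneg (abs_nonneg y) 4
      rcases max_choice 1 (max |x| |y|) with h | h <;> rw [h]
      · linarith
      · rcases max_choice |x| |y| with h | h <;> rw [h] <;> linarith

namespace IsErrorArray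

variable {Ω ι κ : Type*} [MeasurableSpace Ω] [Fintype ι] [Fintype κ] {P : Measure Ω}
  [IsProbabilityMeasure P] {e : ι → Ω → EuclideanSpace ℝ κ} {S : Matrix κ κ ℝ} {C : ℝ}

lemma measurable_coord (he : IsErrorArray P e S C) (t : ι) (i : κ) :
    Measurable fun ω => e t ω i := by
  have := he.measurable t
  fun_prop

lemma integrable_dom (he : IsErrorArray P e S C) (t : ι) (i j : κ) :
    Integrable (fun ω => 1 + e t ω i ^ 4 + e t ω j ^ 4) P :=
  ((integrable_const 1).add (he.integrable_fourth t i)).add (he.integrable_fourth t j)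

lemma integrable_mixed (he : IsErrorArray P e S C) (t : ι) (i j : κ) {l r : ℕ} (h : l + r ≤ 4) :
    Integrable (fun ω => e t ω i ^ l * e t ω j ^ r) P := by
  refine (he.integrable_dom t i j).mono' ?_ (Eventually.of_forall fun ω => ?_)
  · have h1 := he.measurable_coord t i
    have h2 := he.measurable_coord t j
    exact ((h1.pow_const l).mul (h2.pow_const r)).aestronglyMeasurable
  · exact abs_pow_mul_pow_le h

lemma const_nonneg (he : IsErrorArray P e S C) (t : ι) (i : κ) : 0 ≤ C :=
  (integral_nonneg fun _ => by positivity).trans (he.fourth_le t i)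

lemma integral_dom_le (he : IsErrorArray P e S C) (t : ι) (i j : κ) :
    ∫ ω, (1 + e t ω i ^ 4 + e t ω j ^ 4) ∂P ≤ 1 + 2 * C := by
  have h1 : Integrable (fun ω => 1 + e t ω i ^ 4) P :=
    (integrable_const 1).add (he.integrable_fourth t i)
  rw [integral_add h1 (he.integrable_fourth t j),
    integral_add (integrable_const 1) (he.integrable_fourth t i)]
  simp only [integral_const, probReal_univ, smul_eq_mul, one_mul]
  linarith [he.fourth_le t i, he.fourth_le t j]

lemma abs_mixedMoment_le_one_add (he : IsErrorArray P e S C) (t : ι) (i j : κ) {l r : ℕ}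
    (h : l + r ≤ 4) : |mixedMoment P e t i j l r| ≤ 1 + 2 * C :=
  calc |mixedMoment P e t i j l r| ≤ ∫ ω, |e t ω i ^ l * e t ω j ^ r| ∂P :=
        abs_integral_le_integral_abs
    _ ≤ ∫ ω, (1 + e t ω i ^ 4 + e t ω j ^ 4) ∂P :=
        integral_mono (he.integrable_mixed t i j h).abs (he.integrable_dom t i j)
          fun _ => abs_pow_mul_pow_le h
    _ ≤ 1 + 2 * C := he.integral_dom_le t i j

lemma abs_mixedMoment_le (he : IsErrorArray P e S C) (t : ι) (i j : κ) {l r : ℕ}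
    (h : l + r ≤ 4) : |mixedMoment P e t i j l r| ≤ (1 + 2 * C) ^ (l + r) := by
  have hC := he.const_nonneg t i
  rcases Nat.eq_zero_or_pos (l + r) with h0 | h0
  · obtain ⟨rfl, rfl⟩ : l = 0 ∧ r = 0 := by omega
    simp [mixedMoment]
  · exact (he.abs_mixedMoment_le_one_add t i j h).trans (le_self_pow₀ (by linarith) h0.ne')

lemma monomial_mul_monomial (l r : ι → ℕ) (i j : κ) (ω : Ω) :
    monomial e l i ω * monomial e r j ω = ∏ t, (e t ω i ^ l t * e t ω j ^ r t) :=
  Finset.prod_mul_distrib.symm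

lemma integrable_monomial_mul (he : IsErrorArray P e S C) {l r : ι → ℕ} (h : ∀ t, l t + r t ≤ 4)
    (i j : κ) : Integrable (fun ω => monomial e l i ω * monomial e r j ω) P := by
  simp only [monomial_mul_monomial]
  have hf : ∀ t, Measurable fun x : EuclideanSpace ℝ κ => x i ^ l t * x j ^ r t := by
    intro t; fun_prop
  have h1 : Integrable (fun x : ι → EuclideanSpace ℝ κ => ∏ t, (x t i ^ l t * x t j ^ r t))
      (Measure.pi fun t => P.map (e t)) := by
    have : ∀ t, IsProbabilityMeasure (P.map (e t)) := fun t =>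
      Measure.isProbabilityMeasure_map (he.measurable t).aemeasurable
    refine Integrable.fintype_prod (f := fun t (x : EuclideanSpace ℝ κ) =>
      x i ^ l t * x j ^ r t) fun t => ?_
    rw [integrable_map_measure (hf t).aestronglyMeasurable (he.measurable t).aemeasurable]
    exact he.integrable_mixed t i j (h t)
  rw [← he.indep.map_fun_eq_pi_map fun t => (he.measurable t).aemeasurable] at h1
  have hm : Measurable fun ω t => e t ω := measurable_pi_lambda _ he.measurable
  exact h1.comp_measurable hm

lemma integral_monomial_mul (he : IsErrorArray P e S C) (l r : ι → ℕ) (i j : κ) :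
    ∫ ω, monomial e l i ω * monomial e r j ω ∂P = ∏ t, mixedMoment P e t i j (l t) (r t) := by
  simp only [monomial_mul_monomial]
  have hf : ∀ t, Measurable fun x : EuclideanSpace ℝ κ => x i ^ l t * x j ^ r t := by
    intro t; fun_prop
  exact he.indep.integral_fun_prod_comp (f := fun t (x : EuclideanSpace ℝ κ) =>
    x i ^ l t * x j ^ r t) (fun t => (he.measurable t).aemeasurable)
    (fun t => (hf t).aestronglyMeasurable)

lemma integrable_monomial (he : IsErrorArray P e S C) {l : ι → ℕ} (h : ∀ t, l t ≤ 4) (i : κ) :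
    Integrable (monomial e l i) P := by
  have := he.integrable_monomial_mul (l := l) (r := 0) (by simpa using h) i i
  refine this.congr (Eventually.of_forall fun ω => ?_)
  simp [monomial]

lemma integral_monomial_left (he : IsErrorArray P e S C) (l : ι → ℕ) (i j : κ) :
    ∫ ω, monomial e l i ω ∂P = ∏ t, mixedMoment P e t i j (l t) 0 := by
  have := he.integral_monomial_mul l 0 i j
  simpa [monomial] using this

lemma integral_monomial_right (he : IsErrorArray P e S C) (r : ι → ℕ) (i j : κ) :
    ∫ ω, monomial e r j ω ∂P = ∏ t, mixedMoment P e t i j 0 (r t) := by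
  have := he.integral_monomial_mul 0 r i j
  simpa [monomial] using this

end IsErrorArray

/-! ### Covariances of monomials -/

/-- The covariance of the monomials `∏_t e_{it}^{l_t}` and `∏_t e_{jt}^{r_t}`. -/
noncomputable def monomialCov {Ω ι κ : Type*} [MeasurableSpace Ω] [Fintype ι] (P : Measure Ω)
    (e : ι → Ω → EuclideanSpace ℝ κ) (l r : ι → ℕ) (i j : κ) : ℝ :=
  ∫ ω, (monomial e l i ω - ∫ ω', monomial e l i ω' ∂P) *
    (monomial e r j ω - ∫ ω', monomial e r j ω' ∂P) ∂P

namespace IsErrorArray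

variable {Ω ι κ : Type*} [MeasurableSpace Ω] [Fintype ι] [Fintype κ] {P : Measure Ω}
  [IsProbabilityMeasure P] {e : ι → Ω → EuclideanSpace ℝ κ} {S : Matrix κ κ ℝ} {C : ℝ}

lemma mixedMoment_one_zero (he : IsErrorArray P e S C) (t : ι) (i j : κ) :
    mixedMoment P e t i j 1 0 = 0 := by
  simpa [mixedMoment] using he.mean_zero t i

lemma mixedMoment_zero_one (he : IsErrorArray P e S C) (t : ι) (i j : κ) :
    mixedMoment P e t i j 0 1 = 0 := by
  simpa [mixedMoment] using he.mean_zero t j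

lemma mixedMoment_one_one (he : IsErrorArray P e S C) (t : ι) (i j : κ) :
    mixedMoment P e t i j 1 1 = S i j := by
  simpa [mixedMoment] using he.cov t i j

lemma mixedMoment_mul (t : ι) (i j : κ) {l r : ℕ} (h : l = 0 ∨ r = 0) :
    mixedMoment P e t i j l r = mixedMoment P e t i j l 0 * mixedMoment P e t i j 0 r := by
  rcases h with rfl | rfl <;> simp [mixedMoment]

lemma mixedMoment_left (t : ι) (i j j' : κ) (l : ℕ) :
    mixedMoment P e t i j l 0 = mixedMoment P e t i j' l 0 := by
  simp [mixedMoment]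

lemma mixedMoment_right (t : ι) (i i' j : κ) (r : ℕ) :
    mixedMoment P e t i j 0 r = mixedMoment P e t i' j 0 r := by
  simp [mixedMoment]

lemma integrable_centered_mul (he : IsErrorArray P e S C) {l r : ι → ℕ} (hl : ∀ t, l t ≤ 2)
    (hr : ∀ t, r t ≤ 2) (i j : κ) (a b : ℝ) :
    Integrable (fun ω => (monomial e l i ω - a) * (monomial e r j ω - b)) P := by
  have h1 := he.integrable_monomial_mul (l := l) (r := r)
    (fun t => by have := hl t; have := hr t; omega) i j
  have h2 := he.integrable_monomial (l := l) (fun t => by have := hl t; omega) i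
  have h3 := he.integrable_monomial (l := r) (fun t => by have := hr t; omega) j
  have h4 := ((h1.sub (h2.mul_const b)).sub (h3.const_mul a)).add (integrable_const (a * b))
  refine h4.congr (Eventually.of_forall fun ω => ?_)
  simp only [Pi.add_apply, Pi.sub_apply]
  ring

lemma monomialCov_eq (he : IsErrorArray P e S C) {l r : ι → ℕ} (hl : ∀ t, l t ≤ 2)
    (hr : ∀ t, r t ≤ 2) (i j : κ) :
    monomialCov P e l r i j = ∏ t, mixedMoment P e t i j (l t) (r t) -
      (∏ t, mixedMoment P e t i j (l t) 0) * ∏ t, mixedMoment P e t i j 0 (r t) := by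
  have h1 := he.integrable_monomial_mul (l := l) (r := r)
    (fun t => by have := hl t; have := hr t; omega) i j
  have h2 := he.integrable_monomial (l := l) (fun t => by have := hl t; omega) i
  have h3 := he.integrable_monomial (l := r) (fun t => by have := hr t; omega) j
  rw [← he.integral_monomial_mul l r i j, ← he.integral_monomial_left l i j,
    ← he.integral_monomial_right r i j]
  unfold monomialCov
  set a := ∫ ω, monomial e l i ω ∂P
  set b := ∫ ω, monomial e r j ω ∂P
  have : ∀ ω, (monomial e l i ω - a) * (monomial e r j ω - b) =
      monomial e l i ω * monomial e r j ω - monomial e l i ω * b - a * monomial e r j ω + a * b :=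
    fun ω => by ring
  simp only [this]
  have h4 : Integrable (fun ω => monomial e l i ω * monomial e r j ω - monomial e l i ω * b) P :=
    h1.sub (h2.mul_const b)
  have h5 : Integrable (fun ω => monomial e l i ω * monomial e r j ω - monomial e l i ω * b -
    a * monomial e r j ω) P := h4.sub (h3.const_mul a)
  rw [integral_add h5 (integrable_const _), integral_sub h4 (h3.const_mul a),
    integral_sub h1 (h2.mul_const b),
    integral_mul_const, integral_const_mul]
  simp only [integral_const, probReal_univ, smul_eq_mul, one_mul]
  ring

/-- A period in which exactly one error occurs makes the covariance vanish. -/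
lemma monomialCov_eq_zero (he : IsErrorArray P e S C) {l r : ι → ℕ} (hl : ∀ t, l t ≤ 2)
    (hr : ∀ t, r t ≤ 2) {t : ι} (ht : l t + r t = 1) (i j : κ) :
    monomialCov P e l r i j = 0 := by
  rw [he.monomialCov_eq hl hr]
  rcases (by omega : (l t = 1 ∧ r t = 0) ∨ (l t = 0 ∧ r t = 1)) with ⟨h1, h2⟩ | ⟨h1, h2⟩
  · rw [Finset.prod_eq_zero (Finset.mem_univ t) (by rw [h1, h2]; exact he.mixedMoment_one_zero ..),
      Finset.prod_eq_zero (i := t) (f := fun t => mixedMoment P e t i j (l t) 0)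
        (Finset.mem_univ t) (by rw [h1]; exact he.mixedMoment_one_zero ..)]
    simp
  · rw [Finset.prod_eq_zero (Finset.mem_univ t) (by rw [h1, h2]; exact he.mixedMoment_zero_one ..),
      Finset.prod_eq_zero (i := t) (f := fun t => mixedMoment P e t i j 0 (r t))
        (Finset.mem_univ t) (by rw [h2]; exact he.mixedMoment_zero_one ..)]
    simp

lemma abs_prod_mixedMoment_le (he : IsErrorArray P e S C) (hC : 0 ≤ C) {l r : ι → ℕ}
    (hlr : ∀ t, l t + r t ≤ 4) {n : ℕ} (hn : ∑ t, (l t + r t) ≤ n) (s : Finset ι) (i j : κ) :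
    |∏ t ∈ s, mixedMoment P e t i j (l t) (r t)| ≤ (1 + 2 * C) ^ n := by
  rw [Finset.abs_prod]
  calc ∏ t ∈ s, |mixedMoment P e t i j (l t) (r t)|
      ≤ ∏ t ∈ s, (1 + 2 * C) ^ (l t + r t) :=
        Finset.prod_le_prod (fun _ _ => abs_nonneg _)
          fun t _ => he.abs_mixedMoment_le t i j (hlr t)
    _ = (1 + 2 * C) ^ ∑ t ∈ s, (l t + r t) := Finset.prod_pow_eq_pow_sum _ _ _
    _ ≤ (1 + 2 * C) ^ n := by
        refine pow_le_pow_right₀ (by linarith) (le_trans ?_ hn)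
        exact Finset.sum_le_sum_of_subset (Finset.subset_univ s)

lemma abs_monomialCov_le (he : IsErrorArray P e S C) (hC : 0 ≤ C) {l r : ι → ℕ}
    (hl : ∀ t, l t ≤ 2) (hr : ∀ t, r t ≤ 2) {n : ℕ} (hn : ∑ t, (l t + r t) = n) (i j : κ) :
    |monomialCov P e l r i j| ≤ 2 * (1 + 2 * C) ^ n := by
  rw [he.monomialCov_eq hl hr]
  have h1 := he.abs_prod_mixedMoment_le hC (l := l) (r := r)
    (fun t => by have := hl t; have := hr t; omega) hn.le Finset.univ i j
  have h2 := he.abs_prod_mixedMoment_le hC (l := l) (r := 0) (n := ∑ t, l t)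
    (fun t => by have := hl t; simp; omega) (by simp) Finset.univ i j
  have h3 := he.abs_prod_mixedMoment_le hC (l := 0) (r := r) (n := ∑ t, r t)
    (fun t => by have := hr t; simp; omega) (by simp) Finset.univ i j
  simp only [Pi.zero_apply] at h2 h3
  have hK : (0 : ℝ) ≤ 1 + 2 * C := by linarith
  refine (abs_sub _ _).trans ?_
  rw [abs_mul]
  calc _ ≤ (1 + 2 * C) ^ n + (1 + 2 * C) ^ (∑ t, l t) * (1 + 2 * C) ^ (∑ t, r t) := by gcongr
    _ = 2 * (1 + 2 * C) ^ n := by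
        rw [← pow_add, ← Finset.sum_add_distrib, hn]; ring

variable [DecidableEq κ]

/-- If every period that occurs at all occurs exactly twice, then the covariance is `0` unless the
two monomials share a period, and it then carries one factor `S i j` for each shared period. A
single shared period is controlled by the operator norm of `S`, two or more by its Frobenius
norm. -/
lemma abs_sum_monomialCov_le_of_paired (he : IsErrorArray P e S C) (hC : 0 ≤ C) {l r : ι → ℕ}
    (hlr : ∀ t, l t + r t = 0 ∨ l t + r t = 2) {n : ℕ} (hn : ∑ t, (l t + r t) = n)
    {x y : κ → ℝ} {X : ℝ} (hX : 0 ≤ X) (hx : ∀ i, |x i| ≤ X) (hy : ∀ i, |y i| ≤ X) :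
    |∑ i, ∑ j, x i * y j * monomialCov P e l r i j| ≤
      Fintype.card κ * (X ^ 2 * (1 + 2 * C) ^ (3 * n) * (‖S‖ + ‖S‖ ^ 2)) := by
  classical
  have hl : ∀ t, l t ≤ 2 := fun t => by have := hlr t; omega
  have hr : ∀ t, r t ≤ 2 := fun t => by have := hlr t; omega
  set K := 1 + 2 * C with hK
  have hK1 : 1 ≤ K := by linarith
  rcases isEmpty_or_nonempty κ with hκ | ⟨⟨i₀⟩⟩
  · simp
  -- the periods shared by the two monomials
  set W : Finset ι := Finset.univ.filter fun t => l t = 1 with hW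
  have hWmem : ∀ t ∈ W, l t = 1 ∧ r t = 1 := by
    intro t ht
    have h1 : l t = 1 := by simpa [hW] using ht
    have := hlr t
    omega
  have hWc : ∀ t ∈ Wᶜ, l t = 0 ∨ r t = 0 := by
    intro t ht
    have h1 : l t ≠ 1 := by simpa [hW] using ht
    have := hlr t
    omega
  set a : κ → ℝ := fun i => ∏ t ∈ Wᶜ, mixedMoment P e t i i₀ (l t) 0 with ha
  set b : κ → ℝ := fun j => ∏ t ∈ Wᶜ, mixedMoment P e t i₀ j 0 (r t) with hb
  have ha' : ∀ i, |a i| ≤ K ^ n := by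
    intro i
    have h2 := he.abs_prod_mixedMoment_le hC (l := l) (r := 0) (n := n)
      (fun t => by have := hl t; simp; omega)
      (by rw [← hn]; exact Finset.sum_le_sum fun t _ => by simp) Wᶜ i i₀
    simpa only [Pi.zero_apply] using h2
  have hb' : ∀ j, |b j| ≤ K ^ n := by
    intro j
    have h2 := he.abs_prod_mixedMoment_le hC (l := 0) (r := r) (n := n)
      (fun t => by have := hr t; simp; omega)
      (by rw [← hn]; exact Finset.sum_le_sum fun t _ => by simp) Wᶜ i₀ j
    simpa only [Pi.zero_apply] using h2
  have hprod : ∀ i j, ∏ t, mixedMoment P e t i j (l t) (r t) = a i * b j * S i j ^ W.card := by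
    intro i j
    rw [← Finset.prod_compl_mul_prod W]
    congr 1
    · rw [ha, hb, ← Finset.prod_mul_distrib]
      refine Finset.prod_congr rfl fun t ht => ?_
      rw [mixedMoment_mul t i j (hWc t ht), mixedMoment_left t i j i₀, mixedMoment_right t i i₀ j]
    · rw [← Finset.prod_const]
      refine Finset.prod_congr rfl fun t ht => ?_
      rw [(hWmem t ht).1, (hWmem t ht).2, he.mixedMoment_one_one]
  rcases Nat.eq_zero_or_pos W.card with h0 | h0
  · have hzero : ∀ i j, monomialCov P e l r i j = 0 := by
      intro i j
      rw [he.monomialCov_eq hl hr, ← Finset.prod_mul_distrib, sub_eq_zero]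
      refine Finset.prod_congr rfl fun t _ => mixedMoment_mul t i j (hWc t ?_)
      rw [Finset.card_eq_zero.1 h0]; simp
    simp only [hzero, mul_zero, Finset.sum_const_zero, abs_zero]
    positivity
  have hcov : ∀ i j, monomialCov P e l r i j = a i * b j * S i j ^ W.card := by
    intro i j
    obtain ⟨t, ht⟩ := Finset.card_pos.1 h0
    have hz : ∏ t, mixedMoment P e t i j (l t) 0 = 0 :=
      Finset.prod_eq_zero (Finset.mem_univ t)
        (by rw [(hWmem t ht).1]; exact he.mixedMoment_one_zero t i j)
    rw [he.monomialCov_eq hl hr, hprod, hz]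
    ring
  simp only [hcov]
  have hxa : ∀ i, |x i * a i| ≤ X * K ^ n := fun i => by
    rw [abs_mul]; exact mul_le_mul (hx i) (ha' i) (abs_nonneg _) hX
  have hyb : ∀ i, |y i * b i| ≤ X * K ^ n := fun i => by
    rw [abs_mul]; exact mul_le_mul (hy i) (hb' i) (abs_nonneg _) hX
  have hcard0 : (0 : ℝ) ≤ Fintype.card κ := by positivity
  rcases (by omega : W.card = 1 ∨ 2 ≤ W.card) with h1 | h2
  · have h := abs_sum_sum_mul_le S (fun i => x i * a i) (fun i => y i * b i) (by positivity)
      hxa hyb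
    rw [h1]
    have heq : ∀ i j, x i * y j * (a i * b j * S i j ^ 1) = x i * a i * (y j * b j) * S i j :=
      fun i j => by ring
    simp only [heq]
    refine h.trans (mul_le_mul_of_nonneg_left ?_ hcard0)
    calc X * K ^ n * (X * K ^ n) * ‖S‖ = X ^ 2 * K ^ (2 * n) * ‖S‖ := by ring
      _ ≤ X ^ 2 * K ^ (3 * n) * (‖S‖ + ‖S‖ ^ 2) := by
          gcongr
          · norm_num
          · exact le_add_of_nonneg_right (sq_nonneg _)
  · have hWn : W.card ≤ n := by
      rw [← hn, Finset.card_eq_sum_ones]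
      calc ∑ _t ∈ W, 1 ≤ ∑ t ∈ W, (l t + r t) :=
            Finset.sum_le_sum fun t ht => by rw [(hWmem t ht).1]; omega
        _ ≤ _ := Finset.sum_le_sum_of_subset (Finset.subset_univ W)
    have hS : ∀ i j, |S i j| ≤ K := fun i j => by
      obtain ⟨t, ht⟩ := Finset.card_pos.1 h0
      rw [← he.mixedMoment_one_one t i j]
      exact he.abs_mixedMoment_le_one_add t i j (by norm_num)
    have hterm : ∀ i j, |x i * y j * (a i * b j * S i j ^ W.card)| ≤
        X ^ 2 * K ^ (3 * n) * S i j ^ 2 := by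
      intro i j
      have hp : |S i j ^ (W.card - 2)| ≤ K ^ n := by
        rw [abs_pow]
        exact (pow_le_pow_left₀ (abs_nonneg _) (hS i j) _).trans
          (pow_le_pow_right₀ hK1 (by omega))
      have heq : x i * y j * (a i * b j * S i j ^ W.card) =
          (x i * a i) * (y j * b j) * S i j ^ (W.card - 2) * S i j ^ 2 := by
        rw [← pow_mul_pow_sub (S i j) h2]; ring
      rw [heq, abs_mul, abs_mul, abs_mul, abs_of_nonneg (sq_nonneg (S i j))]
      calc _ ≤ (X * K ^ n) * (X * K ^ n) * K ^ n * S i j ^ 2 := by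
            gcongr
            · exact hxa i
            · exact hyb j
        _ = _ := by ring
    calc |∑ i, ∑ j, x i * y j * (a i * b j * S i j ^ W.card)|
        ≤ ∑ i, ∑ j, X ^ 2 * K ^ (3 * n) * S i j ^ 2 := by
          refine (Finset.abs_sum_le_sum_abs _ _).trans (Finset.sum_le_sum fun i _ => ?_)
          exact (Finset.abs_sum_le_sum_abs _ _).trans (Finset.sum_le_sum fun j _ => hterm i j)
      _ = X ^ 2 * K ^ (3 * n) * ∑ i, ∑ j, S i j ^ 2 := by simp only [Finset.mul_sum]
      _ ≤ X ^ 2 * K ^ (3 * n) * (Fintype.card κ * ‖S‖ ^ 2) := by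
          gcongr
          exact sum_sum_sq_le S
      _ = Fintype.card κ * (X ^ 2 * K ^ (3 * n) * ‖S‖ ^ 2) := by ring
      _ ≤ _ := by
          gcongr
          linarith [norm_nonneg S]

/-- Only pairs of monomials that together visit at most half as many periods as they have factors
contribute, and those that visit exactly half as many contribute one power of the cross-section size
less than the trivial bound. -/
lemma abs_sum_monomialCov_le (he : IsErrorArray P e S C) (hC : 0 ≤ C) {l r : ι → ℕ}
    (hl : ∀ t, l t ≤ 2) (hr : ∀ t, r t ≤ 2) {k : ℕ} (hk : ∑ t, (l t + r t) = 2 * k)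
    {x y : κ → ℝ} {X : ℝ} (hX : 0 ≤ X) (hx : ∀ i, |x i| ≤ X) (hy : ∀ i, |y i| ≤ X) :
    |∑ i, ∑ j, x i * y j * monomialCov P e l r i j| ≤
      (if (Finset.univ.filter fun t => l t + r t ≠ 0).card < k then
        (Fintype.card κ : ℝ) ^ 2 * (X ^ 2 * (2 * (1 + 2 * C) ^ (2 * k))) else 0) +
      (if (Finset.univ.filter fun t => l t + r t ≠ 0).card ≤ k then
        Fintype.card κ * (X ^ 2 * (1 + 2 * C) ^ (3 * (2 * k)) * (‖S‖ + ‖S‖ ^ 2)) else 0) := by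
  classical
  set U := Finset.univ.filter fun t => l t + r t ≠ 0 with hU
  have hB : 0 ≤ (if U.card ≤ k then
      Fintype.card κ * (X ^ 2 * (1 + 2 * C) ^ (3 * (2 * k)) * (‖S‖ + ‖S‖ ^ 2)) else 0) := by
    split_ifs <;> positivity
  by_cases h1 : ∃ t, l t + r t = 1
  · obtain ⟨t, ht⟩ := h1
    simp only [he.monomialCov_eq_zero hl hr ht, mul_zero, Finset.sum_const_zero, abs_zero]
    refine add_nonneg ?_ hB
    split_ifs <;> positivity
  push Not at h1
  have hsum : ∑ t ∈ U, (l t + r t) = 2 * k := by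
    rw [← hk]
    refine Finset.sum_subset (Finset.subset_univ U) fun t _ ht => ?_
    simpa [hU] using ht
  have h2 : ∀ t ∈ U, 2 ≤ l t + r t := fun t ht => by
    have h3 : l t + r t ≠ 0 := (Finset.mem_filter.1 ht).2
    have := h1 t
    omega
  have hUk : U.card ≤ k := by
    have := Finset.sum_le_sum h2
    rw [hsum, Finset.sum_const, smul_eq_mul] at this
    omega
  by_cases hlt : U.card < k
  · rw [if_pos hlt]
    refine le_trans ?_ (le_add_of_nonneg_right hB)
    calc _ ≤ ∑ _i : κ, ∑ _j : κ, X ^ 2 * (2 * (1 + 2 * C) ^ (2 * k)) := by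
          refine (Finset.abs_sum_le_sum_abs _ _).trans (Finset.sum_le_sum fun i _ => ?_)
          refine (Finset.abs_sum_le_sum_abs _ _).trans (Finset.sum_le_sum fun j _ => ?_)
          rw [abs_mul, abs_mul, sq]
          exact mul_le_mul (mul_le_mul (hx i) (hy j) (abs_nonneg _) hX)
            (he.abs_monomialCov_le hC hl hr hk i j) (abs_nonneg _) (by positivity)
      _ = _ := by simp; ring
  · rw [if_neg hlt, if_pos hUk, zero_add]
    have hUeq : U.card = k := by omega
    have h3 : ∀ t ∈ U, 2 = l t + r t := by
      rw [← Finset.sum_eq_sum_iff_of_le h2, hsum, Finset.sum_const, smul_eq_mul, hUeq, mul_comm]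
    refine he.abs_sum_monomialCov_le_of_paired hC (fun t => ?_) hk hX hx hy
    by_cases ht : t ∈ U
    · exact Or.inr (h3 t ht).symm
    · left; simpa [hU] using ht

end IsErrorArray

/-! ### Second moments of weighted sums of centred monomials -/

section

variable {Ω ι κ : Type*} [MeasurableSpace Ω] [Fintype ι] [Fintype κ]

/-- The weighted cross-sectional average `N⁻¹ ∑_i g_i ∏_t e_{it}^{l_t}`. -/
noncomputable def avgMonomial (e : ι → Ω → EuclideanSpace ℝ κ) (g : κ → ℝ) (l : ι → ℕ)
    (ω : Ω) : ℝ :=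
  1 / (Fintype.card κ : ℝ) * ∑ i, g i * monomial e l i ω

/-- The average `avgMonomial`, centred at its mean. -/
noncomputable def centeredAvg (P : Measure Ω) (e : ι → Ω → EuclideanSpace ℝ κ) (g : κ → ℝ)
    (l : ι → ℕ) (ω : Ω) : ℝ :=
  avgMonomial e g l ω - ∫ ω', avgMonomial e g l ω' ∂P

/-- The exponents of the product `(∏_{t ∈ α} e_{it}) (∏_{t ∈ β} e_{it})`. -/
def mult [DecidableEq ι] (α β : Finset ι) (t : ι) : ℕ :=
  (if t ∈ α then 1 else 0) + (if t ∈ β then 1 else 0)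

lemma mult_le [DecidableEq ι] (α β : Finset ι) (t : ι) : mult α β t ≤ 2 := by
  unfold mult; split_ifs <;> norm_num

lemma sum_mult [DecidableEq ι] (α β : Finset ι) : ∑ t, mult α β t = α.card + β.card := by
  simp [mult, Finset.sum_add_distrib]

lemma monomial_mult [DecidableEq ι] (e : ι → Ω → EuclideanSpace ℝ κ) (α β : Finset ι) (i : κ)
    (ω : Ω) : monomial e (mult α β) i ω = (∏ t ∈ α, e t ω i) * ∏ t ∈ β, e t ω i := by
  simp only [monomial, mult, pow_add, Finset.prod_mul_distrib]
  simp [pow_ite]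

end

namespace IsErrorArray

variable {Ω ι κ : Type*} {F mΩ : MeasurableSpace Ω} [Fintype ι] [Fintype κ] {P : Measure Ω}
  [IsProbabilityMeasure P] {e : ι → Ω → EuclideanSpace ℝ κ} {S : Matrix κ κ ℝ} {C : ℝ}

lemma centeredAvg_eq (he : IsErrorArray P e S C) {l : ι → ℕ} (hl : ∀ t, l t ≤ 2)
    (g : κ → ℝ) (ω : Ω) : centeredAvg P e g l ω = 1 / (Fintype.card κ : ℝ) *
      ∑ i, g i * (monomial e l i ω - ∫ ω', monomial e l i ω' ∂P) := by
  unfold centeredAvg avgMonomial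
  rw [integral_const_mul, integral_finsetSum _ fun i _ => Integrable.const_mul
    (he.integrable_monomial (fun t => by have := hl t; omega) i) _, ← mul_sub,
    ← Finset.sum_sub_distrib]
  simp only [integral_const_mul, mul_sub]

lemma centeredAvg_mul (he : IsErrorArray P e S C) {l r : ι → ℕ} (hl : ∀ t, l t ≤ 2)
    (hr : ∀ t, r t ≤ 2) (g : κ → ℝ) (ω : Ω) :
    centeredAvg P e g l ω * centeredAvg P e g r ω = 1 / (Fintype.card κ : ℝ) ^ 2 *
      ∑ i, ∑ j, g i * g j * ((monomial e l i ω - ∫ ω', monomial e l i ω' ∂P) *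
        (monomial e r j ω - ∫ ω', monomial e r j ω' ∂P)) := by
  rw [he.centeredAvg_eq hl, he.centeredAvg_eq hr, mul_mul_mul_comm, Finset.sum_mul_sum]
  congr 1
  · ring
  · exact Finset.sum_congr rfl fun i _ => Finset.sum_congr rfl fun j _ => by ring

lemma integrable_centeredAvg_mul (he : IsErrorArray P e S C) {l r : ι → ℕ} (hl : ∀ t, l t ≤ 2)
    (hr : ∀ t, r t ≤ 2) (g : κ → ℝ) :
    Integrable (fun ω => centeredAvg P e g l ω * centeredAvg P e g r ω) P := by
  simp only [he.centeredAvg_mul hl hr]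
  refine Integrable.const_mul ?_ _
  refine integrable_finsetSum _ fun i _ => integrable_finsetSum _ fun j _ => ?_
  exact (he.integrable_centered_mul hl hr i j _ _).const_mul _

lemma integral_centeredAvg_mul (he : IsErrorArray P e S C) {l r : ι → ℕ} (hl : ∀ t, l t ≤ 2)
    (hr : ∀ t, r t ≤ 2) (g : κ → ℝ) :
    ∫ ω, centeredAvg P e g l ω * centeredAvg P e g r ω ∂P = 1 / (Fintype.card κ : ℝ) ^ 2 *
      ∑ i, ∑ j, g i * g j * monomialCov P e l r i j := by
  simp only [he.centeredAvg_mul hl hr]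
  have h := fun i j => (he.integrable_centered_mul hl hr i j
    (∫ ω', monomial e l i ω' ∂P) (∫ ω', monomial e r j ω' ∂P)).const_mul (g i * g j)
  rw [integral_const_mul, integral_finsetSum _ fun i _ => integrable_finsetSum _ fun j _ => h i j]
  congr 1
  refine Finset.sum_congr rfl fun i _ => ?_
  rw [integral_finsetSum _ fun j _ => h i j]
  exact Finset.sum_congr rfl fun j _ => integral_const_mul _ _

lemma measurable_monomial (l : ι → ℕ) (i : κ) :
    Measurable (monomial (fun t (x : ι → EuclideanSpace ℝ κ) => x t) l i) := by
  unfold monomial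
  refine Finset.measurable_prod _ fun t _ => Measurable.pow_const ?_ _
  fun_prop

lemma measurable_avgMonomial (g : κ → ℝ) (l : ι → ℕ) :
    Measurable (avgMonomial (fun t (x : ι → EuclideanSpace ℝ κ) => x t) g l) := by
  unfold avgMonomial
  exact (Finset.measurable_sum _ fun i _ => (measurable_monomial l i).const_mul _).const_mul _

/-- Common variables are independent of functions of the errors. -/
lemma indepFun_centeredAvg_mul
    (hindep : Indep (MeasurableSpace.comap (fun ω t => e t ω) inferInstance) F P)
    {c : Ω → ℝ} (hc : Measurable[F] c) (g : κ → ℝ) (l r : ι → ℕ) :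
    IndepFun c (fun ω => centeredAvg P e g l ω * centeredAvg P e g r ω) P := by
  have h1 : IndepFun (fun ω t => e t ω) c P := by
    rw [IndepFun_iff_Indep]
    exact indep_of_indep_of_le_right hindep hc.comap_le
  have h2 : Measurable fun x : ι → EuclideanSpace ℝ κ =>
      (avgMonomial (fun t (x : ι → EuclideanSpace ℝ κ) => x t) g l x -
        ∫ ω', avgMonomial e g l ω' ∂P) *
      (avgMonomial (fun t (x : ι → EuclideanSpace ℝ κ) => x t) g r x -
        ∫ ω', avgMonomial e g r ω' ∂P) :=
    ((measurable_avgMonomial g l).sub_const _).mul ((measurable_avgMonomial g r).sub_const _)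
  exact (h1.comp h2 measurable_id).symm

/-- Conditioning on the common variables bounds the second moment of a weighted sum of centred
averages by the absolute covariances of the averages alone. -/
lemma integral_sq_sum_le_of_indep (he : IsErrorArray P e S C) (hF : F ≤ mΩ)
    (hindep : Indep (MeasurableSpace.comap (fun ω t => e t ω) inferInstance) F P)
    {X : Type*} (Q : Finset X) {l : X → ι → ℕ} (hl : ∀ x t, l x t ≤ 2)
    {c : X → Ω → ℝ} (hc : ∀ x, Measurable[F] (c x))
    (hint : ∀ x, Integrable (fun ω => c x ω ^ 2) P) {V : ℝ} (hV : ∀ x, ∫ ω, c x ω ^ 2 ∂P ≤ V)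
    (g : κ → ℝ) :
    Integrable (fun ω => (∑ x ∈ Q, c x ω * centeredAvg P e g (l x) ω) ^ 2) P ∧
    ∫ ω, (∑ x ∈ Q, c x ω * centeredAvg P e g (l x) ω) ^ 2 ∂P ≤
      V * ∑ x ∈ Q, ∑ y ∈ Q,
        |∫ ω, centeredAvg P e g (l x) ω * centeredAvg P e g (l y) ω ∂P| := by
  have hcc : ∀ x y, Integrable (fun ω => c x ω * c y ω) P := by
    intro x y
    refine ((hint x).add (hint y)).mono' ?_ (Eventually.of_forall fun ω => ?_)
    · exact (((hc x).mono hF le_rfl).mul ((hc y).mono hF le_rfl)).aestronglyMeasurable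
    · simp only [Pi.add_apply, Real.norm_eq_abs]
      rw [abs_le]
      constructor <;> nlinarith [sq_nonneg (c x ω + c y ω), sq_nonneg (c x ω - c y ω),
        sq_nonneg (c x ω), sq_nonneg (c y ω)]
  have hccV : ∀ x y, |∫ ω, c x ω * c y ω ∂P| ≤ V := by
    intro x y
    have h1 : ∫ ω, |c x ω * c y ω| ∂P ≤ ∫ ω, (1 / 2) * (c x ω ^ 2 + c y ω ^ 2) ∂P := by
      refine integral_mono (hcc x y).abs (((hint x).add (hint y)).const_mul _) fun ω => ?_
      simp only
      rw [abs_le]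
      constructor <;> nlinarith [sq_nonneg (c x ω + c y ω), sq_nonneg (c x ω - c y ω)]
    rw [integral_const_mul, integral_add (hint x) (hint y)] at h1
    linarith [abs_integral_le_integral_abs (f := fun ω => c x ω * c y ω) (μ := P), hV x, hV y]
  have hind : ∀ x y, IndepFun (fun ω => c x ω * c y ω)
      (fun ω => centeredAvg P e g (l x) ω * centeredAvg P e g (l y) ω) P := fun x y =>
    indepFun_centeredAvg_mul hindep ((hc x).mul (hc y)) g (l x) (l y)
  have hcent := fun x y => he.integrable_centeredAvg_mul (hl x) (hl y) g
  have hprod : ∀ x y, Integrable (fun ω => (c x ω * c y ω) *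
      (centeredAvg P e g (l x) ω * centeredAvg P e g (l y) ω)) P := fun x y =>
    (hind x y).integrable_mul (hcc x y) (hcent x y)
  have hexp : ∀ ω, (∑ x ∈ Q, c x ω * centeredAvg P e g (l x) ω) ^ 2 =
      ∑ x ∈ Q, ∑ y ∈ Q, (c x ω * c y ω) *
        (centeredAvg P e g (l x) ω * centeredAvg P e g (l y) ω) := by
    intro ω
    rw [sq, Finset.sum_mul_sum]
    exact Finset.sum_congr rfl fun x _ => Finset.sum_congr rfl fun y _ => by ring
  simp only [hexp]
  refine ⟨integrable_finsetSum _ fun x _ => integrable_finsetSum _ fun y _ => hprod x y, ?_⟩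
  rw [integral_finsetSum _ fun x _ => integrable_finsetSum _ fun y _ => hprod x y, Finset.mul_sum]
  refine Finset.sum_le_sum fun x _ => ?_
  rw [integral_finsetSum _ fun y _ => hprod x y, Finset.mul_sum]
  refine Finset.sum_le_sum fun y _ => ?_
  have h2 := (hind x y).integral_mul_eq_mul_integral (hcc x y).aestronglyMeasurable
    (hcent x y).aestronglyMeasurable
  simp only [Pi.mul_apply] at h2
  rw [h2]
  refine (le_abs_self _).trans ?_
  rw [abs_mul]
  exact mul_le_mul_of_nonneg_right (hccV x y) (abs_nonneg _)

variable [DecidableEq ι] [DecidableEq κ] [Nonempty ι] [Nonempty κ]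

/-- The number of pairs of monomials that matter is at most a constant times `T ^ k`, and only
a constant times `T ^ (k - 1)` of them miss the factor `1 / N`. -/
lemma sum_abs_centeredAvg_cov_le (he : IsErrorArray P e S C) (hC : 0 ≤ C)
    {X : Type*} (Q : Finset X) {α β : X → Finset ι} (hinj : Set.InjOn (fun x => (α x, β x)) Q)
    {k : ℕ} (hk : 1 ≤ k) (hcard : ∀ x ∈ Q, (α x).card + (β x).card = k)
    {g : κ → ℝ} {G : ℝ} (hG : 0 ≤ G) (hg : ∀ i, |g i| ≤ G) :
    ∑ x ∈ Q, ∑ y ∈ Q, |∫ ω, centeredAvg P e g (mult (α x) (β x)) ω *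
        centeredAvg P e g (mult (α y) (β y)) ω ∂P| ≤
      (Fintype.card ι : ℝ) ^ k * (2 ^ (k * 4) * G ^ 2 * (2 * (1 + 2 * C) ^ (2 * k) +
        (1 + 2 * C) ^ (3 * (2 * k)) * (‖S‖ + ‖S‖ ^ 2)) *
        (1 / Fintype.card ι + 1 / Fintype.card κ)) := by
  classical
  set n : ℝ := (Fintype.card κ : ℝ) with hn
  set T : ℝ := (Fintype.card ι : ℝ) with hT
  have hn0 : 0 < n := by rw [hn]; exact_mod_cast Fintype.card_pos
  have hT0 : 0 < T := by rw [hT]; exact_mod_cast Fintype.card_pos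
  set K := 1 + 2 * C with hK
  have hK0 : 0 ≤ K := by rw [hK]; linarith
  set A : ℝ := 2 * K ^ (2 * k) with hA
  set B : ℝ := K ^ (3 * (2 * k)) * (‖S‖ + ‖S‖ ^ 2) with hB
  have hA0 : 0 ≤ A := by positivity
  have hB0 : 0 ≤ B := by positivity
  let U : X × X → Finset ι := fun z => Finset.univ.filter fun t =>
    mult (α z.1) (β z.1) t + mult (α z.2) (β z.2) t ≠ 0
  let τ : X × X → Fin 4 → Finset ι := fun z => ![α z.1, β z.1, α z.2, β z.2]
  have hU : ∀ z, Finset.univ.biUnion (τ z) = U z := by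
    intro z
    ext t
    simp only [τ, U, Finset.mem_biUnion, Finset.mem_univ, true_and, Fin.exists_fin_succ, mult]
    simp only [Matrix.cons_val_zero, Matrix.cons_val_succ, IsEmpty.exists_iff, or_false]
    by_cases h1 : t ∈ α z.1 <;> by_cases h2 : t ∈ β z.1 <;> by_cases h3 : t ∈ α z.2 <;>
      by_cases h4 : t ∈ β z.2 <;> simp [h1, h2, h3, h4]
  have hτ : Set.InjOn τ (Q ×ˢ Q : Finset (X × X)) := by
    rintro ⟨x, y⟩ hz ⟨x', y'⟩ hz' h
    simp only [Finset.coe_product, Set.mem_prod, Finset.mem_coe] at hz hz'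
    have e0 := congrFun h 0
    have e1 := congrFun h 1
    have e2 := congrFun h 2
    have e3 := congrFun h 3
    simp only [τ, Matrix.cons_val] at e0 e1 e2 e3
    exact Prod.ext (hinj hz.1 hz'.1 (Prod.ext e0 e1)) (hinj hz.2 hz'.2 (Prod.ext e2 e3))
  have hcount : ∀ r, (((Q ×ˢ Q).filter fun z => (U z).card ≤ r).card : ℝ) ≤
      T ^ r * 2 ^ (r * 4) := by
    intro r
    have := card_le_of_card_union_le ((Q ×ˢ Q).filter fun z => (U z).card ≤ r) τ (n := 4) (r := r)
      (hτ.mono (by exact_mod_cast Finset.filter_subset _ _))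
      (fun z hz => by rw [hU]; exact (Finset.mem_filter.1 hz).2)
    rw [hT]
    exact_mod_cast this
  have hterm : ∀ z ∈ Q ×ˢ Q, |∫ ω, centeredAvg P e g (mult (α z.1) (β z.1)) ω *
        centeredAvg P e g (mult (α z.2) (β z.2)) ω ∂P| ≤
      (if (U z).card ≤ k - 1 then G ^ 2 * A else 0) +
      (if (U z).card ≤ k then G ^ 2 * B * (1 / n) else 0) := by
    intro z hz
    rw [Finset.mem_product] at hz
    rw [he.integral_centeredAvg_mul (mult_le _ _) (mult_le _ _), abs_mul,
      abs_of_nonneg (by positivity)]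
    have h := he.abs_sum_monomialCov_le hC (mult_le (α z.1) (β z.1)) (mult_le (α z.2) (β z.2))
      (k := k) (by rw [Finset.sum_add_distrib, sum_mult, sum_mult, hcard _ hz.1, hcard _ hz.2,
        two_mul]) hG hg hg
    calc _ ≤ 1 / n ^ 2 * ((if (U z).card < k then n ^ 2 * (G ^ 2 * A) else 0) +
          (if (U z).card ≤ k then n * (G ^ 2 * K ^ (3 * (2 * k)) * (‖S‖ + ‖S‖ ^ 2)) else 0)) :=
          mul_le_mul_of_nonneg_left h (by positivity)
      _ = _ := by
          have h1 : (U z).card < k ↔ (U z).card ≤ k - 1 := by omega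
          simp only [h1, mul_add, mul_ite, mul_zero]
          congr 1
          · congr 1
            field_simp
          · congr 1
            rw [hB]
            field_simp
  have hpow : T ^ k * (1 / T) = T ^ (k - 1) := by
    obtain ⟨k, rfl⟩ : ∃ j, k = j + 1 := ⟨k - 1, by omega⟩
    rw [pow_succ, Nat.add_sub_cancel]
    field_simp
  rw [← Finset.sum_product']
  calc _ ≤ ∑ z ∈ Q ×ˢ Q, ((if (U z).card ≤ k - 1 then G ^ 2 * A else 0) +
        (if (U z).card ≤ k then G ^ 2 * B * (1 / n) else 0)) := Finset.sum_le_sum hterm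
    _ = ((Q ×ˢ Q).filter fun z => (U z).card ≤ k - 1).card * (G ^ 2 * A) +
        ((Q ×ˢ Q).filter fun z => (U z).card ≤ k).card * (G ^ 2 * B * (1 / n)) := by
        rw [Finset.sum_add_distrib, ← Finset.sum_filter, ← Finset.sum_filter, Finset.sum_const,
          Finset.sum_const, nsmul_eq_mul, nsmul_eq_mul]
    _ ≤ T ^ (k - 1) * 2 ^ ((k - 1) * 4) * (G ^ 2 * A) +
        T ^ k * 2 ^ (k * 4) * (G ^ 2 * B * (1 / n)) := by
        gcongr
        · exact hcount _
        · exact hcount _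
    _ ≤ T ^ (k - 1) * 2 ^ (k * 4) * (G ^ 2 * A) +
        T ^ k * 2 ^ (k * 4) * (G ^ 2 * B * (1 / n)) := by
        gcongr
        · norm_num
        · omega
    _ = 2 ^ (k * 4) * G ^ 2 * (A * (T ^ k * (1 / T)) + B * (T ^ k * (1 / n))) := by
        rw [hpow]; ring
    _ ≤ 2 ^ (k * 4) * G ^ 2 * ((A + B) * (T ^ k * (1 / T)) + (A + B) * (T ^ k * (1 / n))) := by
        gcongr <;> linarith
    _ = _ := by ring

end IsErrorArray

/-! ### The errors of the model form an error array -/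

lemma condProb_of_indep {Ω : Type*} {m' m mΩ : MeasurableSpace Ω} {μ : Measure Ω}
    [IsProbabilityMeasure μ] (hm' : m' ≤ mΩ) (hm : m ≤ mΩ) (hind : Indep m' m μ) {B : Set Ω}
    (hB : MeasurableSet[m'] B) : μ⟦B | m⟧ =ᵐ[μ] fun _ => μ.real B := by
  have hsm : StronglyMeasurable[m'] (B.indicator fun _ => (1 : ℝ)) :=
    StronglyMeasurable.indicator (@stronglyMeasurable_const _ _ m' _ _) hB
  have h := condExp_indep_eq hm' hm hsm hind
  have h2 : ∫ ω, B.indicator (fun _ => (1 : ℝ)) ω ∂μ = μ.real B := by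
    rw [integral_indicator (hm' _ hB)]
    simp
  rwa [h2] at h

/-- Conditionally independent variables that are jointly independent of the conditioning
sigma-algebra are independent: their conditional probabilities are constants. -/
lemma iIndepFun_of_condIndependent {Ω ι E : Type*} [MeasurableSpace E] {m mΩ : MeasurableSpace Ω}
    {μ : Measure Ω} [IsProbabilityMeasure μ] {X : ι → Ω → E} (hm : m ≤ mΩ)
    (hX : ∀ t, Measurable (X t)) (hcond : CondIndependent m μ X)
    (hind : Indep (MeasurableSpace.comap (fun ω t => X t ω) inferInstance) m μ) :
    iIndepFun X μ := by
  rw [iIndepFun_iff_measure_inter_preimage_eq_mul]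
  intro S A hA
  have hle : MeasurableSpace.comap (fun ω t => X t ω) inferInstance ≤ mΩ :=
    (measurable_pi_lambda _ hX).comap_le
  have hmeas : ∀ t ∈ S,
      MeasurableSet[MeasurableSpace.comap (fun ω t => X t ω) inferInstance] (X t ⁻¹' A t) :=
    fun t ht => ⟨(fun x => x t) ⁻¹' A t, measurable_pi_apply t (hA t ht), rfl⟩
  have hall : ∀ᵐ ω ∂μ, ∀ t ∈ S, (μ⟦X t ⁻¹' A t | m⟧) ω = μ.real (X t ⁻¹' A t) :=
    (Finset.eventually_all S).2 fun t ht => condProb_of_indep hle hm hind (hmeas t ht)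
  have hconst : ∀ᵐ ω ∂μ, μ.real (⋂ t ∈ S, X t ⁻¹' A t) = ∏ t ∈ S, μ.real (X t ⁻¹' A t) := by
    filter_upwards [condProb_of_indep hle hm hind (S.measurableSet_biInter hmeas),
      hcond S A hA, hall] with ω h1 h2 h3
    rw [← h1, h2, Finset.prod_apply]
    exact Finset.prod_congr rfl h3
  obtain ⟨_, h⟩ := hconst.exists
  rw [← ENNReal.toReal_eq_toReal_iff' (measure_ne_top _ _)
    (ENNReal.prod_ne_top fun _ _ => measure_ne_top _ _), ENNReal.toReal_prod]
  exact h

lemma integrable_pow_four_of_lintegral_le {Ω : Type*} [MeasurableSpace Ω] {P : Measure Ω}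
    {f : Ω → ℝ} (hf : AEStronglyMeasurable f P) {C : ℝ≥0} (h : ∫⁻ ω, ‖f ω‖ₑ ^ 4 ∂P ≤ C) :
    Integrable (fun ω => f ω ^ 4) P ∧ ∫ ω, f ω ^ 4 ∂P ≤ C := by
  have hE : ∀ ω, ENNReal.ofReal (f ω ^ 4) = ‖f ω‖ₑ ^ 4 := by
    intro ω
    have : f ω ^ 4 = ‖f ω‖ ^ 4 := by
      rw [Real.norm_eq_abs, ← abs_pow, abs_of_nonneg (by positivity)]
    rw [this, ENNReal.ofReal_pow (norm_nonneg _), ofReal_norm]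
  have hi : Integrable (fun ω => f ω ^ 4) P := by
    refine ⟨hf.pow 4, ?_⟩
    rw [HasFiniteIntegral]
    simp only [enorm_pow]
    exact h.trans_lt ENNReal.coe_lt_top
  refine ⟨hi, ?_⟩
  rw [integral_eq_lintegral_of_nonneg_ae (Eventually.of_forall fun _ => by positivity)
    hi.aestronglyMeasurable]
  simp only [hE]
  exact ENNReal.toReal_le_of_le_ofReal C.2 (by simpa using h)

namespace Model

variable {kγ kv kw N T : ℕ} (M : Model.{u} kγ kv kw N T)

lemma errorCov_apply (hT : 0 < T) (i j : Fin N) :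
    M.errorCov i j = ∫ ω, M.e ⟨0, hT⟩ ω i * M.e ⟨0, hT⟩ ω j ∂M.P := by
  simp [errorCov, hT, secondMoment]

lemma errorCov_comm (i j : Fin N) : M.errorCov i j = M.errorCov j i := by
  by_cases hT : 0 < T
  · simp only [errorCov_apply M hT, mul_comm]
  · simp [errorCov, hT]

lemma measurable_e_coord (t : Fin T) (i : Fin N) : Measurable fun ω => M.e t ω i := by
  have := M.measurable_e t
  fun_prop

end Model

lemma isErrorArray {kγ kv kw : ℕ} {M : PanelArray.{u} kγ kv kw} {a : ℝ}
    {Γσ : Matrix (Fin kγ) (Fin kγ) ℝ} (herr : Errors M) (hind : Independence M a Γσ) :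
    ∃ C : ℝ, 0 ≤ C ∧ ∀ p : ℕ × ℕ, 0 < p.2 →
      IsErrorArray (M p).P (M p).e (M p).errorCov C := by
  obtain ⟨C, hC⟩ := herr.moment
  refine ⟨C, C.2, fun p hp => ?_⟩
  have h4 := fun t i => integrable_pow_four_of_lintegral_le
    ((M p).measurable_e_coord t i).aestronglyMeasurable (hC p i t)
  refine ⟨(M p).measurable_e, iIndepFun_of_condIndependent (M p).F_le (M p).measurable_e
    (herr.condIndep p) (hind.indep p), fun t i => ?_, fun t i => (h4 t i).1,
    fun t i => (h4 t i).2, fun t i j => ?_⟩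
  · have hint : Integrable ((M p).e t) (M p).P := by
      refine Integrable.of_eval_piLp fun i => ?_
      refine ((integrable_const 1).add (h4 t i).1).mono'
        ((M p).measurable_e_coord t i).aestronglyMeasurable (Eventually.of_forall fun ω => ?_)
      have h := abs_pow_mul_pow_le (x := (M p).e t ω i) (y := 0) (l := 1) (r := 0) (by norm_num)
      simpa using h
    have h0 : ∫ ω, (M p).e t ω ∂(M p).P = 0 := by
      rw [← integral_condExp (M p).F_le, integral_congr_ae (herr.condExp_zero p t)]
      simp
    rw [← eval_integral_piLp fun i => hint.eval_piLp i, h0]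
    simp
  · rw [Model.errorCov_apply _ hp]
    have hm : Measurable fun x : EuclideanSpace ℝ (Fin p.1) => x i * x j := by fun_prop
    exact ((hind.identDistrib p t ⟨0, hp⟩).comp hm).integral_eq

/-! ### The components of `ξ_i` as sums over pairs of periods -/

/-- The periods `{s, t}` of a pair `(s, t)`; a single period `s` is encoded as the pair `(s, s)`. -/
def pairSet {T : ℕ} (a : Fin T × Fin T) : Finset (Fin T) := {a.1, a.2}

section Components

variable {kγ kv kw N T : ℕ}

/-- The pairs of periods over which a component of `ξ_i` sums: the diagonal for the linear
components, the pairs `(s, t)` with `t < s` for the quadratic ones. -/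
def compDom (T : ℕ) : (Fin kγ × Fin kv) ⊕ Fin kw → Finset (Fin T × Fin T)
  | .inl _ => Finset.univ.filter fun a => a.1 = a.2
  | .inr _ => Finset.univ.filter fun a => a.2 < a.1

/-- The number of errors in each term of a component of `ξ_i`. -/
def compOrder : (Fin kγ × Fin kv) ⊕ Fin kw → ℕ
  | .inl _ => 1
  | .inr _ => 2

/-- The normalisation `T^{-1/2}` or `T^{-1}` of a component of `ξ_i`. -/
noncomputable def compScale (T : ℕ) : (Fin kγ × Fin kv) ⊕ Fin kw → ℝ
  | .inl _ => 1 / √(T : ℝ)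
  | .inr _ => 1 / (T : ℝ)

/-- The non-random weight of unit `i` in a component of `ξ_i`. -/
def Model.compLoad (M : Model.{u} kγ kv kw N T) : (Fin kγ × Fin kv) ⊕ Fin kw → Fin N → ℝ
  | .inl q => fun i => M.γ i q.1
  | .inr _ => fun _ => 1

/-- The common variable multiplying the errors of a pair of periods in a component of `ξ_i`. -/
def Model.compCoef (M : Model.{u} kγ kv kw N T) :
    (Fin kγ × Fin kv) ⊕ Fin kw → Fin T × Fin T → M.Ω → ℝ
  | .inl q => fun a ω => M.v a.1 ω q.2
  | .inr c => fun a ω => M.w a.1 a.2 ω c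

lemma card_pairSet {j : (Fin kγ × Fin kv) ⊕ Fin kw} {a : Fin T × Fin T} (ha : a ∈ compDom T j) :
    (pairSet a).card = compOrder j := by
  rcases j with q | c <;> simp only [compDom, Finset.mem_filter, Finset.mem_univ, true_and] at ha
  · simp [pairSet, compOrder, ha]
  · simp [pairSet, compOrder, Finset.card_pair ha.ne']

lemma eq_of_pairSet_eq {j j' : (Fin kγ × Fin kv) ⊕ Fin kw} {a b : Fin T × Fin T}
    (ha : a ∈ compDom T j) (hb : b ∈ compDom T j') (h : pairSet a = pairSet b) : a = b := by
  have h1 : a.1 ∈ pairSet b := by rw [← h]; simp [pairSet]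
  have h2 : a.2 ∈ pairSet b := by rw [← h]; simp [pairSet]
  have h3 : b.1 ∈ pairSet a := by rw [h]; simp [pairSet]
  have h4 : b.2 ∈ pairSet a := by rw [h]; simp [pairSet]
  obtain ⟨a1, a2⟩ := a
  obtain ⟨b1, b2⟩ := b
  simp only [pairSet, Finset.mem_insert, Finset.mem_singleton, Fin.ext_iff] at h1 h2 h3 h4
  have h5 : a2 ≤ a1 := by rcases j with q | c <;> simp [compDom] at ha <;> omega
  have h6 : b2 ≤ b1 := by rcases j' with q | c <;> simp [compDom] at hb <;> omega
  rw [Fin.le_def] at h5 h6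
  ext <;> simp only <;> omega

lemma sum_compDom_inl (q : Fin kγ × Fin kv) (f : Fin T × Fin T → ℝ) :
    ∑ a ∈ compDom T (.inl q : (Fin kγ × Fin kv) ⊕ Fin kw), f a = ∑ s, f (s, s) := by
  simp [compDom, Finset.sum_filter, Fintype.sum_prod_type]

lemma sum_compDom_inr (c : Fin kw) (f : Fin T × Fin T → ℝ) :
    ∑ a ∈ compDom T (.inr c : (Fin kγ × Fin kv) ⊕ Fin kw), f a =
      ∑ s, ∑ t ∈ Finset.Iio s, f (s, t) := by
  simp only [compDom, Finset.sum_filter, Fintype.sum_prod_type]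
  refine Finset.sum_congr rfl fun s _ => ?_
  rw [← Finset.sum_filter]
  refine Finset.sum_congr ?_ fun _ _ => rfl
  ext t
  simp

lemma compScale_sq (T : ℕ) (j : (Fin kγ × Fin kv) ⊕ Fin kw) :
    compScale T j ^ 2 = (1 / (T : ℝ)) ^ compOrder j := by
  rcases j with q | c <;> simp [compScale, compOrder]

namespace Model

variable (M : Model.{u} kγ kv kw N T)

lemma xi_eq (i : Fin N) (ω : M.Ω) (j : (Fin kγ × Fin kv) ⊕ Fin kw) :
    M.xi i ω j = compScale T j * (M.compLoad j i *
      ∑ a ∈ compDom T j, M.compCoef j a ω * ∏ t ∈ pairSet a, M.e t ω i) := by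
  rcases j with q | c
  · simp only [xi, xiV, Sum.elim_inl, sum_compDom_inl, compScale, compLoad, compCoef, pairSet,
      Finset.mul_sum]
    refine Finset.sum_congr rfl fun s _ => ?_
    rw [Finset.insert_eq_of_mem (Finset.mem_singleton_self s), Finset.prod_singleton]
    ring
  · simp only [xi, xiW, Sum.elim_inr, sum_compDom_inr, compScale, compLoad, compCoef, pairSet,
      Finset.mul_sum]
    refine Finset.sum_congr rfl fun s _ => Finset.sum_congr rfl fun t ht => ?_
    rw [Finset.prod_pair (Finset.mem_Iio.1 ht).ne']
    ring

lemma varEstimator_apply (ω : M.Ω) (j j' : (Fin kγ × Fin kv) ⊕ Fin kw) :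
    M.varEstimator ω j j' = compScale T j * compScale T j' *
      ∑ x ∈ compDom T j ×ˢ compDom T j', (M.compCoef j x.1 ω * M.compCoef j' x.2 ω) *
        avgMonomial M.e (fun i => M.compLoad j i * M.compLoad j' i)
          (mult (pairSet x.1) (pairSet x.2)) ω := by
  have h : ∀ i, M.xi i ω j * M.xi i ω j' = compScale T j * compScale T j' *
      ∑ x ∈ compDom T j ×ˢ compDom T j', (M.compCoef j x.1 ω * M.compCoef j' x.2 ω) *
        (M.compLoad j i * M.compLoad j' i *
          monomial M.e (mult (pairSet x.1) (pairSet x.2)) i ω) := by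
    intro i
    rw [xi_eq, xi_eq, mul_mul_mul_comm, mul_mul_mul_comm (M.compLoad j i), Finset.sum_mul_sum,
      ← Finset.sum_product', Finset.mul_sum]
    congr 1
    refine Finset.sum_congr rfl fun x _ => ?_
    rw [monomial_mult]
    ring
  simp only [varEstimator, Matrix.smul_apply, Matrix.sum_apply, Matrix.vecMulVec_apply, h,
    smul_eq_mul, avgMonomial, Fintype.card_fin]
  rw [← Finset.mul_sum, Finset.sum_comm]
  simp only [Finset.mul_sum]
  exact Finset.sum_congr rfl fun x _ => Finset.sum_congr rfl fun i _ => by ring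

/-- The entry of the estimator with every average of errors replaced by its mean: only the
products of a pair of periods with itself survive. -/
noncomputable def meanPart (j j' : (Fin kγ × Fin kv) ⊕ Fin kw) (ω : M.Ω) : ℝ :=
  compScale T j * compScale T j' *
    (∑ a ∈ compDom T j ∩ compDom T j', M.compCoef j a ω * M.compCoef j' a ω) *
    (1 / (N : ℝ) * ∑ i, M.compLoad j i * M.compLoad j' i * M.errorCov i i ^ compOrder j)

end Model

end Components

lemma IsErrorArray.integral_avgMonomial_mult {Ω ι κ : Type*} [MeasurableSpace Ω] [Fintype ι]
    [Fintype κ] [DecidableEq ι] {P : Measure Ω} [IsProbabilityMeasure P]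
    {e : ι → Ω → EuclideanSpace ℝ κ} {S : Matrix κ κ ℝ} {C : ℝ} (he : IsErrorArray P e S C)
    (g : κ → ℝ) (α β : Finset ι) :
    ∫ ω, avgMonomial e g (mult α β) ω ∂P =
      if α = β then 1 / (Fintype.card κ : ℝ) * ∑ i, g i * S i i ^ α.card else 0 := by
  have hint : ∀ i, Integrable (monomial e (mult α β) i) P := he.integrable_monomial
    fun t => (mult_le α β t).trans (by norm_num)
  have h1 : ∫ ω, avgMonomial e g (mult α β) ω ∂P =
      1 / (Fintype.card κ : ℝ) * ∑ i, g i * ∫ ω, monomial e (mult α β) i ω ∂P := by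
    unfold avgMonomial
    rw [integral_const_mul, integral_finsetSum _ fun i _ => (hint i).const_mul _]
    simp only [integral_const_mul]
  rw [h1]
  split_ifs with h
  · subst h
    congr 1
    refine Finset.sum_congr rfl fun i _ => ?_
    rw [he.integral_monomial_left _ i i]
    congr 1
    have h2 : ∀ t, mixedMoment P e t i i (mult α α t) 0 = if t ∈ α then S i i else 1 := by
      intro t
      unfold mult
      split_ifs
      · rw [← he.cov t i i]
        simp [mixedMoment, sq]
      · simp [mixedMoment]
    simp [h2]
  · obtain ⟨t, ht⟩ : ∃ t, mult α β t = 1 := by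
      by_contra! hne
      refine h (Finset.ext fun t => ?_)
      have := hne t
      unfold mult at this
      by_cases h3 : t ∈ α <;> by_cases h4 : t ∈ β <;> simp_all
    rw [Finset.sum_eq_zero, mul_zero]
    intro i _
    rw [he.integral_monomial_left _ i i, Finset.prod_eq_zero (Finset.mem_univ t), mul_zero]
    rw [ht, he.mixedMoment_one_zero]

lemma Model.varEstimator_sub_meanPart {kγ kv kw N T : ℕ} (M : Model.{u} kγ kv kw N T) {C : ℝ}
    (he : IsErrorArray M.P M.e M.errorCov C) (ω : M.Ω) (j j' : (Fin kγ × Fin kv) ⊕ Fin kw) :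
    M.varEstimator ω j j' - M.meanPart j j' ω = compScale T j * compScale T j' *
      ∑ x ∈ compDom T j ×ˢ compDom T j', (M.compCoef j x.1 ω * M.compCoef j' x.2 ω) *
        centeredAvg M.P M.e (fun i => M.compLoad j i * M.compLoad j' i)
          (mult (pairSet x.1) (pairSet x.2)) ω := by
  set y : ℝ := 1 / (N : ℝ) *
    ∑ i, M.compLoad j i * M.compLoad j' i * M.errorCov i i ^ compOrder j with hy
  have hmean : M.meanPart j j' ω = compScale T j * compScale T j' *
      ∑ x ∈ compDom T j ×ˢ compDom T j', (M.compCoef j x.1 ω * M.compCoef j' x.2 ω) *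
        ∫ ω', avgMonomial M.e (fun i => M.compLoad j i * M.compLoad j' i)
          (mult (pairSet x.1) (pairSet x.2)) ω' ∂M.P := by
    rw [meanPart, mul_assoc, ← hy]
    congr 1
    rw [Finset.sum_product, Finset.sum_mul]
    have hterm : ∀ a ∈ compDom T j, ∑ b ∈ compDom T j',
        (M.compCoef j a ω * M.compCoef j' b ω) *
          ∫ ω', avgMonomial M.e (fun i => M.compLoad j i * M.compLoad j' i)
            (mult (pairSet a) (pairSet b)) ω' ∂M.P =
        if a ∈ compDom T j' then (M.compCoef j a ω * M.compCoef j' a ω) * y else 0 := by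
      intro a ha
      have h : ∀ b ∈ compDom T j', (M.compCoef j a ω * M.compCoef j' b ω) *
          ∫ ω', avgMonomial M.e (fun i => M.compLoad j i * M.compLoad j' i)
            (mult (pairSet a) (pairSet b)) ω' ∂M.P =
          if a = b then (M.compCoef j a ω * M.compCoef j' b ω) * y else 0 := by
        intro b hb
        rw [he.integral_avgMonomial_mult]
        by_cases hab : a = b
        · subst hab
          simp only [if_true, card_pairSet ha, hy, Fintype.card_fin]
        · rw [if_neg hab, if_neg fun h => hab (eq_of_pairSet_eq ha hb h), mul_zero]
      rw [Finset.sum_congr rfl h, Finset.sum_ite_eq]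
    rw [Finset.sum_congr rfl hterm, ← Finset.sum_filter, Finset.filter_mem_eq_inter]
  rw [varEstimator_apply, hmean, ← mul_sub, ← Finset.sum_sub_distrib]
  simp only [centeredAvg, mul_sub]

/-! ### Convergence to zero in probability -/

section NullInProb

variable {kγ kv kw : ℕ} {M : PanelArray.{u} kγ kv kw} {X Y : ∀ p, (M p).Ω → ℝ}

/-- Convergence to zero in probability of real variables living on different probability spaces. -/
def NullInProb (M : PanelArray.{u} kγ kv kw) (X : ∀ p, (M p).Ω → ℝ) : Prop :=
  ∀ ε : ℝ, 0 < ε → Tendsto (fun p => (M p).P {ω | ε ≤ |X p ω|}) atTop (𝓝 0)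

namespace NullInProb

lemma of_lintegral_sq {b : ℕ × ℕ → ℝ≥0∞}
    (hX : ∀ᶠ p in atTop, AEMeasurable (fun ω => ‖X p ω ^ 2‖ₑ) (M p).P ∧
      ∫⁻ ω, ‖X p ω ^ 2‖ₑ ∂(M p).P ≤ b p) (hb : Tendsto b atTop (𝓝 0)) : NullInProb M X := by
  intro ε hε
  have hc : ENNReal.ofReal (ε ^ 2) ≠ 0 := by simpa using hε.ne'
  have hb' : Tendsto (fun p => b p / ENNReal.ofReal (ε ^ 2)) atTop (𝓝 0) := by
    simpa using ENNReal.Tendsto.div_const hb (Or.inr hc)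
  refine tendsto_of_tendsto_of_tendsto_of_le_of_le' tendsto_const_nhds hb'
    (Eventually.of_forall fun _ => zero_le) (hX.mono fun p hp => ?_)
  refine (measure_mono ?_).trans ((meas_ge_le_lintegral_div hp.1 hc ENNReal.ofReal_ne_top).trans
    (ENNReal.div_le_div_right hp.2 _))
  intro ω hω
  simp only [Set.mem_ofPred_eq] at hω ⊢
  rw [Real.enorm_eq_ofReal (sq_nonneg _), ← sq_abs (X p ω)]
  exact ENNReal.ofReal_le_ofReal (pow_le_pow_left₀ hε.le hω 2)

lemma of_integral_sq {b : ℕ × ℕ → ℝ}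
    (hX : ∀ᶠ p in atTop, Integrable (fun ω => X p ω ^ 2) (M p).P ∧
      ∫ ω, X p ω ^ 2 ∂(M p).P ≤ b p) (hb : Tendsto b atTop (𝓝 0)) : NullInProb M X := by
  refine of_lintegral_sq (b := fun p => ENNReal.ofReal (b p)) (hX.mono fun p hp => ⟨?_, ?_⟩) ?_
  · exact hp.1.aestronglyMeasurable.enorm
  · rw [← ofReal_integral_norm_eq_lintegral_enorm hp.1]
    refine ENNReal.ofReal_le_ofReal ?_
    simpa using hp.2
  · simpa using ENNReal.tendsto_ofReal hb

lemma mono (hY : NullInProb M Y) (h : ∀ᶠ p in atTop, ∀ ω, |X p ω| ≤ |Y p ω|) :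
    NullInProb M X := by
  intro ε hε
  refine tendsto_of_tendsto_of_tendsto_of_le_of_le' tendsto_const_nhds (hY ε hε)
    (Eventually.of_forall fun _ => zero_le) (h.mono fun p hp => measure_mono fun ω hω => ?_)
  simp only [Set.mem_ofPred_eq] at hω ⊢
  exact hω.trans (hp ω)

lemma add (hX : NullInProb M X) (hY : NullInProb M Y) :
    NullInProb M fun p ω => X p ω + Y p ω := by
  intro ε hε
  have h := (hX (ε / 2) (by positivity)).add (hY (ε / 2) (by positivity))
  rw [add_zero] at h
  refine tendsto_of_tendsto_of_tendsto_of_le_of_le tendsto_const_nhds h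
    (fun _ => zero_le) fun p => (measure_mono fun ω hω => ?_).trans (measure_union_le _ _)
  simp only [Set.mem_ofPred_eq, Set.mem_union] at hω ⊢
  by_contra! hcon
  linarith [abs_add_le (X p ω) (Y p ω)]

lemma of_tendsto {y : ℕ × ℕ → ℝ} (hy : Tendsto y atTop (𝓝 0)) :
    NullInProb M fun p _ => y p := by
  intro ε hε
  refine Tendsto.congr' ?_ tendsto_const_nhds
  have h := (tendsto_order.1 hy.abs).2 ε (by simpa using hε)
  refine h.mono fun p hp => ?_
  simp [not_le.2 hp]

lemma mul_of_tendsto (hX : NullInProb M X) {y : ℕ × ℕ → ℝ} {η : ℝ}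
    (hy : Tendsto y atTop (𝓝 η)) : NullInProb M fun p ω => X p ω * y p := by
  intro ε hε
  have hY : 0 < |η| + 1 := by positivity
  have h := (tendsto_order.1 hy.abs).2 (|η| + 1) (by linarith)
  refine tendsto_of_tendsto_of_tendsto_of_le_of_le' tendsto_const_nhds
    (hX (ε / (|η| + 1)) (by positivity)) (Eventually.of_forall fun _ => zero_le)
    (h.mono fun p hp => measure_mono fun ω hω => ?_)
  simp only [Set.mem_ofPred_eq] at hω ⊢
  rw [abs_mul] at hω
  rw [div_le_iff₀ hY]
  exact hω.trans (mul_le_mul_of_nonneg_left hp.le (abs_nonneg _))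

lemma sum {J : Type*} (s : Finset J) {Z : J → ∀ p, (M p).Ω → ℝ}
    (hZ : ∀ j ∈ s, NullInProb M (Z j)) : NullInProb M fun p ω => ∑ j ∈ s, Z j p ω := by
  classical
  induction s using Finset.induction_on with
  | empty => simpa using of_tendsto (M := M) (y := fun _ => 0) tendsto_const_nhds
  | insert j s hj ih =>
    simp only [Finset.sum_insert hj]
    exact (hZ j (Finset.mem_insert_self _ _)).add
      (ih fun i hi => hZ i (Finset.mem_insert_of_mem hi))

/-- A product of a convergent random factor and a convergent non-random one. -/
lemma mul_sub_mul {b y : ℕ × ℕ → ℝ} {β η : ℝ} (hX : NullInProb M fun p ω => X p ω - b p)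
    (hb : Tendsto b atTop (𝓝 β)) (hy : Tendsto y atTop (𝓝 η)) :
    NullInProb M fun p ω => X p ω * y p - β * η := by
  have h1 := hX.mul_of_tendsto hy
  have h2 : Tendsto (fun p => b p * y p - β * η) atTop (𝓝 0) := by
    simpa using (hb.mul hy).sub_const (β * η)
  refine (h1.add (of_tendsto h2)).mono (Eventually.of_forall fun p ω => le_of_eq ?_)
  congr 1
  ring

end NullInProb

end NullInProb

/-! ### The deviation from the mean part vanishes -/

section Deviation

variable {kγ kv kw : ℕ} {M : PanelArray.{u} kγ kv kw}

lemma measurable_compCoef {Ωv : Matrix (Fin kv) (Fin kv) ℝ} {Ωw : Matrix (Fin kw) (Fin kw) ℝ}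
    (hcommon : CommonVars M Ωv Ωw) (p : ℕ × ℕ) (j : (Fin kγ × Fin kv) ⊕ Fin kw)
    (a : Fin p.2 × Fin p.2) : Measurable[(M p).F] ((M p).compCoef j a) := by
  rcases j with q | c
  · have h : Measurable fun x : EuclideanSpace ℝ (Fin kv) => x q.2 := by fun_prop
    exact h.comp (hcommon.measurable_v p a.1)
  · have h : Measurable fun x : EuclideanSpace ℝ (Fin kw) => x c := by fun_prop
    exact h.comp (hcommon.measurable_w p a.1 a.2)

lemma compCoef_fourth {Ωv : Matrix (Fin kv) (Fin kv) ℝ} {Ωw : Matrix (Fin kw) (Fin kw) ℝ}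
    (hcommon : CommonVars M Ωv Ωw) : ∃ V : ℝ, 0 ≤ V ∧
      ∀ (p : ℕ × ℕ) (j : (Fin kγ × Fin kv) ⊕ Fin kw) (a : Fin p.2 × Fin p.2),
        Integrable (fun ω => (M p).compCoef j a ω ^ 4) (M p).P ∧
        ∫ ω, (M p).compCoef j a ω ^ 4 ∂(M p).P ≤ V := by
  obtain ⟨Cv, hv⟩ := hcommon.moment_v
  obtain ⟨Cw, hw⟩ := hcommon.moment_w
  refine ⟨(max Cv Cw : ℝ≥0), NNReal.coe_nonneg _, fun p j a => ?_⟩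
  refine integrable_pow_four_of_lintegral_le
    ((measurable_compCoef hcommon p j a).mono (M p).F_le le_rfl).aestronglyMeasurable ?_
  have hcoord : ∀ {k : ℕ} (x : EuclideanSpace ℝ (Fin k)) (i : Fin k), ‖x i‖ₑ ≤ ‖x‖ₑ :=
    fun x i => enorm_le_iff_norm_le.2 (PiLp.norm_apply_le x i)
  rcases j with q | c
  · refine (lintegral_mono fun ω => ?_).trans
      ((hv p a.1).trans (ENNReal.coe_le_coe.2 (le_max_left _ _)))
    exact pow_le_pow_left' (hcoord _ _) 4
  · refine (lintegral_mono fun ω => ?_).trans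
      ((hw p a.1 a.2).trans (ENNReal.coe_le_coe.2 (le_max_right _ _)))
    exact pow_le_pow_left' (hcoord _ _) 4

lemma integral_sq_mul_le {Ω : Type*} [MeasurableSpace Ω] {P : Measure Ω} {f g : Ω → ℝ} {V : ℝ}
    (hfm : Measurable f) (hgm : Measurable g)
    (hf : Integrable (fun ω => f ω ^ 4) P ∧ ∫ ω, f ω ^ 4 ∂P ≤ V)
    (hg : Integrable (fun ω => g ω ^ 4) P ∧ ∫ ω, g ω ^ 4 ∂P ≤ V) :
    Integrable (fun ω => (f ω * g ω) ^ 2) P ∧ ∫ ω, (f ω * g ω) ^ 2 ∂P ≤ V := by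
  have hdom : Integrable (fun ω => (1 / 2) * (f ω ^ 4 + g ω ^ 4)) P :=
    (hf.1.add hg.1).const_mul _
  have hle : ∀ ω, (f ω * g ω) ^ 2 ≤ (1 / 2) * (f ω ^ 4 + g ω ^ 4) := fun ω => by
    nlinarith [sq_nonneg (f ω ^ 2 - g ω ^ 2)]
  have hi : Integrable (fun ω => (f ω * g ω) ^ 2) P := by
    refine hdom.mono' ((hfm.mul hgm).pow_const 2).aestronglyMeasurable
      (Eventually.of_forall fun ω => ?_)
    rw [Real.norm_of_nonneg (sq_nonneg _)]
    exact hle ω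
  refine ⟨hi, (integral_mono hi hdom hle).trans ?_⟩
  rw [integral_const_mul, integral_add hf.1 hg.1]
  linarith [hf.2, hg.2]

lemma abs_compLoad_le {C : ℝ} (hload : ∀ p i, ‖(M p).γ i‖ ≤ C) (p : ℕ × ℕ)
    (j : (Fin kγ × Fin kv) ⊕ Fin kw) (i : Fin p.1) : |(M p).compLoad j i| ≤ 1 + |C| := by
  rcases j with q | c
  · have h := PiLp.norm_apply_le ((M p).γ i) q.1
    have h2 := hload p i
    have h3 := le_abs_self C
    simp only [Model.compLoad]
    rw [Real.norm_eq_abs] at h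
    linarith
  · simp [Model.compLoad]

lemma eventually_pos : ∀ᶠ p : ℕ × ℕ in atTop, 0 < p.1 ∧ 0 < p.2 := by
  filter_upwards [eventually_ge_atTop ((1, 1) : ℕ × ℕ)] with p hp
  exact ⟨hp.1, hp.2⟩

lemma tendsto_inv_sizes :
    Tendsto (fun p : ℕ × ℕ => 1 / (p.2 : ℝ) + 1 / (p.1 : ℝ)) atTop (𝓝 0) := by
  have h : Tendsto (fun n : ℕ => 1 / (n : ℝ)) atTop (𝓝 0) := tendsto_one_div_atTop_nhds_zero_nat
  have h1 : Tendsto (fun p : ℕ × ℕ => p.1) atTop atTop := by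
    rw [← prod_atTop_atTop_eq]; exact tendsto_fst
  have h2 : Tendsto (fun p : ℕ × ℕ => p.2) atTop atTop := by
    rw [← prod_atTop_atTop_eq]; exact tendsto_snd
  simpa using (h.comp h2).add (h.comp h1)

/-- The error covariance matrices are eventually bounded in operator norm: the off-diagonal part is
small and the variances are bounded by the fourth moments. -/
lemma eventually_norm_errorCov_le {C : ℝ} (hC : 0 ≤ C)
    (he : ∀ p : ℕ × ℕ, 0 < p.2 → IsErrorArray (M p).P (M p).e (M p).errorCov C)
    (hdiag : Tendsto (fun p => ‖(M p).errorCov - dg (M p).errorCov‖) atTop (𝓝 0)) :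
    ∀ᶠ p in atTop, ‖(M p).errorCov‖ ≤ 2 + 2 * C := by
  filter_upwards [(tendsto_order.1 hdiag).2 1 one_pos, eventually_pos] with p h1 hp
  have h2 : ‖dg (M p).errorCov‖ ≤ 1 + 2 * C := by
    rw [dg, Matrix.l2_opNorm_diagonal]
    refine (pi_norm_le_iff_of_nonneg (by linarith)).2 fun i => ?_
    rw [Real.norm_eq_abs, Matrix.diag_apply, ← (he p hp.2).mixedMoment_one_one ⟨0, hp.2⟩ i i]
    exact (he p hp.2).abs_mixedMoment_le_one_add _ i i (by norm_num)
  have h3 := norm_add_le ((M p).errorCov - dg (M p).errorCov) (dg (M p).errorCov)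
  rw [sub_add_cancel] at h3
  linarith

/-- The entries of the estimator differ from their mean parts by a term whose second moment is of
order `1 / T + 1 / N`. -/
lemma nullInProb_sub_meanPart {Ωv : Matrix (Fin kv) (Fin kv) ℝ} {Ωw : Matrix (Fin kw) (Fin kw) ℝ}
    {a : ℝ} {Γσ : Matrix (Fin kγ) (Fin kγ) ℝ} (hcommon : CommonVars M Ωv Ωw)
    (hload : Loadings M) (herr : Errors M) (hind : Independence M a Γσ)
    (hdiag : Tendsto (fun p => ‖(M p).errorCov - dg (M p).errorCov‖) atTop (𝓝 0))
    (j j' : (Fin kγ × Fin kv) ⊕ Fin kw) :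
    NullInProb M fun p ω => (M p).varEstimator ω j j' - (M p).meanPart j j' ω := by
  obtain ⟨C, hC, he⟩ := isErrorArray herr hind
  obtain ⟨V, hV0, hV⟩ := compCoef_fourth hcommon
  obtain ⟨D, hD⟩ := hload
  have hnorm := eventually_norm_errorCov_le hC he hdiag
  set k := compOrder j + compOrder j' with hk
  have hk1 : 1 ≤ k := by rcases j with q | c <;> simp [hk, compOrder]; omega
  set H := 2 + 2 * C with hH
  set B : ℝ := 2 ^ (k * 4) * ((1 + |D|) ^ 2) ^ 2 * (2 * (1 + 2 * C) ^ (2 * k) +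
    (1 + 2 * C) ^ (3 * (2 * k)) * (H + H ^ 2)) with hB
  refine NullInProb.of_integral_sq (b := fun p => V * (B * (1 / (p.2 : ℝ) + 1 / (p.1 : ℝ)))) ?_
    (by simpa using (tendsto_inv_sizes.const_mul B).const_mul V)
  filter_upwards [hnorm, eventually_pos] with p hp hpos
  have : Nonempty (Fin p.1) := ⟨⟨0, hpos.1⟩⟩
  have : Nonempty (Fin p.2) := ⟨⟨0, hpos.2⟩⟩
  have hcm := measurable_compCoef hcommon p
  have hc2 := fun x : (Fin p.2 × Fin p.2) × (Fin p.2 × Fin p.2) =>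
    integral_sq_mul_le ((hcm j x.1).mono (M p).F_le le_rfl) ((hcm j' x.2).mono (M p).F_le le_rfl)
      (hV p j x.1) (hV p j' x.2)
  have h1 := (he p hpos.2).integral_sq_sum_le_of_indep (M p).F_le (hind.indep p)
    (compDom p.2 j ×ˢ compDom p.2 j') (l := fun x => mult (pairSet x.1) (pairSet x.2))
    (fun x t => mult_le _ _ t) (c := fun x ω => (M p).compCoef j x.1 ω * (M p).compCoef j' x.2 ω)
    (fun x => (hcm j x.1).mul (hcm j' x.2)) (fun x => (hc2 x).1) (fun x => (hc2 x).2)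
    (fun i => (M p).compLoad j i * (M p).compLoad j' i)
  have h2 := (he p hpos.2).sum_abs_centeredAvg_cov_le hC (compDom p.2 j ×ˢ compDom p.2 j')
    (α := fun x => pairSet x.1) (β := fun x => pairSet x.2) (k := k)
    (by
      rintro ⟨x1, x2⟩ hx ⟨y1, y2⟩ hy hxy
      simp only [Finset.coe_product, Set.mem_prod, Finset.mem_coe] at hx hy
      simp only [Prod.mk.injEq] at hxy
      exact Prod.ext (eq_of_pairSet_eq hx.1 hy.1 hxy.1) (eq_of_pairSet_eq hx.2 hy.2 hxy.2))
    hk1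
    (fun x hx => by
      rw [Finset.mem_product] at hx
      rw [card_pairSet hx.1, card_pairSet hx.2])
    (g := fun i => (M p).compLoad j i * (M p).compLoad j' i) (G := (1 + |D|) ^ 2) (by positivity)
    (fun i => by
      rw [abs_mul, sq]
      exact mul_le_mul (abs_compLoad_le hD p j i) (abs_compLoad_le hD p j' i) (abs_nonneg _)
        (by positivity))
  simp only [Fintype.card_fin] at h2
  have heq : ∀ ω, ((M p).varEstimator ω j j' - (M p).meanPart j j' ω) ^ 2 =
      (1 / (p.2 : ℝ)) ^ k * (∑ x ∈ compDom p.2 j ×ˢ compDom p.2 j',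
        ((M p).compCoef j x.1 ω * (M p).compCoef j' x.2 ω) *
        centeredAvg (M p).P (M p).e (fun i => (M p).compLoad j i * (M p).compLoad j' i)
          (mult (pairSet x.1) (pairSet x.2)) ω) ^ 2 := by
    intro ω
    rw [Model.varEstimator_sub_meanPart _ (he p hpos.2), mul_pow, mul_pow, compScale_sq,
      compScale_sq, ← pow_add]
  simp only [heq]
  refine ⟨h1.1.const_mul _, ?_⟩
  rw [integral_const_mul]
  have hT : (0 : ℝ) < p.2 := by exact_mod_cast hpos.2
  have hK : (0 : ℝ) ≤ 1 + 2 * C := by linarith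
  refine (mul_le_mul_of_nonneg_left (h1.2.trans (mul_le_mul_of_nonneg_left h2 hV0))
    (by positivity)).trans ?_
  calc _ = ((1 / (p.2 : ℝ)) ^ k * (p.2 : ℝ) ^ k) * (V * (2 ^ (k * 4) * ((1 + |D|) ^ 2) ^ 2 *
        (2 * (1 + 2 * C) ^ (2 * k) + (1 + 2 * C) ^ (3 * (2 * k)) *
        (‖(M p).errorCov‖ + ‖(M p).errorCov‖ ^ 2)) * (1 / (p.2 : ℝ) + 1 / (p.1 : ℝ)))) := by ring
    _ = V * (2 ^ (k * 4) * ((1 + |D|) ^ 2) ^ 2 *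
        (2 * (1 + 2 * C) ^ (2 * k) + (1 + 2 * C) ^ (3 * (2 * k)) *
        (‖(M p).errorCov‖ + ‖(M p).errorCov‖ ^ 2)) * (1 / (p.2 : ℝ) + 1 / (p.1 : ℝ))) := by
        rw [← mul_pow, one_div_mul_cancel hT.ne', one_pow, one_mul]
    _ ≤ _ := by rw [hB]; gcongr

end Deviation

/-! ### The limit of the mean part -/

section MeanPart

variable {kγ kv kw : ℕ} {M : PanelArray.{u} kγ kv kw}

lemma tendsto_of_abs_sub_le {ι : Type*} {l : Filter ι} {f g b : ι → ℝ} {η : ℝ}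
    (hf : Tendsto f l (𝓝 η)) (hb : Tendsto b l (𝓝 0)) (h : ∀ᶠ x in l, |f x - g x| ≤ b x) :
    Tendsto g l (𝓝 η) := by
  have h0 : Tendsto (fun x => f x - g x) l (𝓝 0) := squeeze_zero_norm' h hb
  simpa using hf.sub h0

/-- The case `n = 0` holds because `1 / 0 = 0`, so that no positivity of the size is needed. -/
lemma one_div_mul_le_of_le_mul {n x y : ℝ} (hn : 0 ≤ n) (hy : 0 ≤ y) (h : x ≤ n * y) :
    1 / n * x ≤ y := by
  rcases hn.eq_or_lt with rfl | hn
  · simpa using hy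
  · rw [one_div, inv_mul_le_iff₀ hn]
    exact h

/-- Replacing the error covariance by its diagonal does not change the limit of
`N⁻¹ γ' (E e_t e_t') γ`. -/
lemma tendsto_diag_gamma {a : ℝ} {Γσ : Matrix (Fin kγ) (Fin kγ) ℝ} (hload : Loadings M)
    (hind : Independence M a Γσ)
    (hdiag : Tendsto (fun p => ‖(M p).errorCov - dg (M p).errorCov‖) atTop (𝓝 0))
    (b c : Fin kγ) :
    Tendsto (fun p => 1 / (p.1 : ℝ) * ∑ i, (M p).γ i b * (M p).γ i c * (M p).errorCov i i)
      atTop (𝓝 (Γσ b c)) := by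
  obtain ⟨D, hD⟩ := hload
  have hγ : ∀ p i b, |(M p).γ i b| ≤ |D| := fun p i b => by
    have h := PiLp.norm_apply_le ((M p).γ i) b
    rw [Real.norm_eq_abs] at h
    exact h.trans ((hD p i).trans (le_abs_self D))
  have hlim : Tendsto (fun p => ((1 / (p.1 : ℝ)) • ((M p).gammaMatrix.transpose *
      (M p).errorCov * (M p).gammaMatrix)) b c) atTop (𝓝 (Γσ b c)) :=
    ((continuous_apply_apply b c).tendsto Γσ).comp hind.tendsto_gamma
  have hzero : Tendsto (fun p => |D| * |D| * ‖(M p).errorCov - dg (M p).errorCov‖) atTop (𝓝 0) := by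
    simpa using hdiag.const_mul (|D| * |D|)
  refine tendsto_of_abs_sub_le hlim hzero (Eventually.of_forall fun p => ?_)
  have heq : ((1 / (p.1 : ℝ)) • ((M p).gammaMatrix.transpose *
      (M p).errorCov * (M p).gammaMatrix)) b c -
      1 / (p.1 : ℝ) * ∑ i, (M p).γ i b * (M p).γ i c * (M p).errorCov i i =
      1 / (p.1 : ℝ) * ∑ i, ∑ k, (M p).γ i b * (M p).γ k c *
        ((M p).errorCov - dg (M p).errorCov) i k := by
    rw [Matrix.smul_apply, smul_eq_mul, ← mul_sub]
    congr 1
    simp only [Matrix.mul_apply, Finset.sum_mul, Matrix.transpose_apply, Model.gammaMatrix,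
      Matrix.of_apply, Matrix.sub_apply, mul_sub, Finset.sum_sub_distrib, dg,
      Matrix.diagonal_apply, Matrix.diag_apply, mul_ite, mul_zero, Finset.sum_ite_eq,
      Finset.mem_univ, if_true]
    rw [Finset.sum_comm]
    congr 1
    exact Finset.sum_congr rfl fun i _ => Finset.sum_congr rfl fun k _ => by ring
  rw [heq, abs_mul, abs_of_nonneg (by positivity)]
  refine one_div_mul_le_of_le_mul (by positivity) (by positivity) ?_
  simpa using abs_sum_sum_mul_le ((M p).errorCov - dg (M p).errorCov)
    (fun i => (M p).γ i b) (fun i => (M p).γ i c) (abs_nonneg D) (fun i => hγ p i b)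
    (fun i => hγ p i c)

/-- Replacing the error covariance by its diagonal does not change the limit of the normalised trace
of its square. -/
lemma tendsto_diag_sq {a : ℝ} {Γσ : Matrix (Fin kγ) (Fin kγ) ℝ} (hind : Independence M a Γσ)
    (hdiag : Tendsto (fun p => ‖(M p).errorCov - dg (M p).errorCov‖) atTop (𝓝 0)) :
    Tendsto (fun p => 1 / (p.1 : ℝ) * ∑ i, (M p).errorCov i i ^ 2) atTop (𝓝 a) := by
  have hzero : Tendsto (fun p => ‖(M p).errorCov - dg (M p).errorCov‖ ^ 2) atTop (𝓝 0) := by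
    simpa using hdiag.pow 2
  refine tendsto_of_abs_sub_le hind.tendsto_trace hzero (Eventually.of_forall fun p => ?_)
  have heq : 1 / (p.1 : ℝ) * ((M p).errorCov ^ 2).trace -
      1 / (p.1 : ℝ) * ∑ i, (M p).errorCov i i ^ 2 =
      1 / (p.1 : ℝ) * ∑ i, ∑ k, ((M p).errorCov - dg (M p).errorCov) i k ^ 2 := by
    rw [← mul_sub]
    congr 1
    rw [sq, Matrix.trace, ← Finset.sum_sub_distrib]
    refine Finset.sum_congr rfl fun i _ => ?_
    rw [Matrix.diag_apply, Matrix.mul_apply, ← Finset.sum_erase_add _ _ (Finset.mem_univ i),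
      ← Finset.sum_erase_add (a := i) (f := fun k => ((M p).errorCov - dg (M p).errorCov) i k ^ 2)
        _ (Finset.mem_univ i)]
    have h1 : ((M p).errorCov - dg (M p).errorCov) i i ^ 2 = 0 := by simp [dg]
    have h2 : ∀ k ∈ Finset.univ.erase i, (M p).errorCov i k * (M p).errorCov k i =
        ((M p).errorCov - dg (M p).errorCov) i k ^ 2 := by
      intro k hk
      have : i ≠ k := (Finset.ne_of_mem_erase hk).symm
      rw [(M p).errorCov_comm k i]
      simp [dg, this, sq]
    rw [Finset.sum_congr rfl h2, h1]
    ring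
  rw [heq, abs_of_nonneg (by positivity)]
  refine one_div_mul_le_of_le_mul (by positivity) (by positivity) ?_
  simpa using sum_sum_sq_le ((M p).errorCov - dg (M p).errorCov)

/-- An entry of a random matrix that tends to zero in mean square tends to zero in probability. -/
lemma nullInProb_entry {ι : Type*} [Fintype ι] [DecidableEq ι]
    {Z : ∀ p, (M p).Ω → Matrix ι ι ℝ}
    (hZ : Tendsto (fun p => ∫⁻ ω, ‖Z p ω‖ₑ ^ 2 ∂(M p).P) atTop (𝓝 0)) (i k : ι)
    (hm : ∀ p, Measurable fun ω => Z p ω i k) : NullInProb M fun p ω => Z p ω i k := by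
  refine NullInProb.of_lintegral_sq (Eventually.of_forall fun p => ⟨?_, ?_⟩) hZ
  · exact ((hm p).pow_const 2).enorm.aemeasurable
  · refine lintegral_mono fun ω => ?_
    rw [enorm_pow]
    refine pow_le_pow_left' (enorm_le_iff_norm_le.2 ?_) 2
    exact abs_entry_le_norm _ _ _

lemma measurable_coord_v {Ωv : Matrix (Fin kv) (Fin kv) ℝ} {Ωw : Matrix (Fin kw) (Fin kw) ℝ}
    (hcommon : CommonVars M Ωv Ωw) (p : ℕ × ℕ) (s : Fin p.2) (c : Fin kv) :
    Measurable fun ω => (M p).v s ω c := by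
  have h : Measurable fun x : EuclideanSpace ℝ (Fin kv) => x c := by fun_prop
  exact h.comp ((hcommon.measurable_v p s).mono (M p).F_le le_rfl)

lemma measurable_coord_w {Ωv : Matrix (Fin kv) (Fin kv) ℝ} {Ωw : Matrix (Fin kw) (Fin kw) ℝ}
    (hcommon : CommonVars M Ωv Ωw) (p : ℕ × ℕ) (s t : Fin p.2) (c : Fin kw) :
    Measurable fun ω => (M p).w s t ω c := by
  have h : Measurable fun x : EuclideanSpace ℝ (Fin kw) => x c := by fun_prop
  exact h.comp ((hcommon.measurable_w p s t).mono (M p).F_le le_rfl)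

lemma nullInProb_meanPart_inl {Ωv : Matrix (Fin kv) (Fin kv) ℝ} {Ωw : Matrix (Fin kw) (Fin kw) ℝ}
    {a : ℝ} {Γσ : Matrix (Fin kγ) (Fin kγ) ℝ} (hcommon : CommonVars M Ωv Ωw)
    (hload : Loadings M) (hind : Independence M a Γσ)
    (hdiag : Tendsto (fun p => ‖(M p).errorCov - dg (M p).errorCov‖) atTop (𝓝 0))
    (q q' : Fin kγ × Fin kv) :
    NullInProb M fun p ω => (M p).meanPart (.inl q) (.inl q') ω -
      Ωv q.2 q'.2 * Γσ q.1 q'.1 := by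
  have hlln := nullInProb_entry hcommon.lln_v q.2 q'.2 fun p => by
    simp only [Matrix.smul_apply, Matrix.sum_apply, Matrix.sub_apply, outer, Matrix.of_apply,
      smul_eq_mul]
    refine (Finset.measurable_sum _ fun s _ => ?_).const_mul _
    exact ((measurable_coord_v hcommon p s _).mul (measurable_coord_v hcommon p s _)).sub_const _
  have hb : Tendsto (fun p => ((1 / (p.2 : ℝ)) • ∑ s, secondMoment (M p).P ((M p).v s)) q.2 q'.2)
      atTop (𝓝 (Ωv q.2 q'.2)) :=
    ((continuous_apply_apply q.2 q'.2).tendsto Ωv).comp hcommon.tendsto_v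
  have hX : NullInProb M fun p ω => 1 / (p.2 : ℝ) * (∑ s, (M p).v s ω q.2 * (M p).v s ω q'.2) -
      ((1 / (p.2 : ℝ)) • ∑ s, secondMoment (M p).P ((M p).v s)) q.2 q'.2 := by
    refine hlln.mono (Eventually.of_forall fun p ω => le_of_eq ?_)
    congr 1
    simp only [Matrix.smul_apply, Matrix.sum_apply, Matrix.sub_apply, outer, Matrix.of_apply,
      Finset.sum_sub_distrib, smul_eq_mul, mul_sub]
  refine (hX.mul_sub_mul hb (tendsto_diag_gamma hload hind hdiag q.1 q'.1)).mono
    (Eventually.of_forall fun p ω => le_of_eq ?_)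
  rw [Model.meanPart]
  have hdom : compDom p.2 (.inl q : (Fin kγ × Fin kv) ⊕ Fin kw) ∩
      compDom p.2 (.inl q' : (Fin kγ × Fin kv) ⊕ Fin kw) =
      compDom p.2 (.inl q : (Fin kγ × Fin kv) ⊕ Fin kw) := Finset.inter_self _
  rw [hdom, sum_compDom_inl]
  simp only [Model.compCoef, Model.compLoad, compOrder, pow_one, compScale]
  rw [div_mul_div_comm, one_mul, Real.mul_self_sqrt (Nat.cast_nonneg _)]

lemma nullInProb_meanPart_inr {Ωv : Matrix (Fin kv) (Fin kv) ℝ} {Ωw : Matrix (Fin kw) (Fin kw) ℝ}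
    {a : ℝ} {Γσ : Matrix (Fin kγ) (Fin kγ) ℝ} (hcommon : CommonVars M Ωv Ωw)
    (hind : Independence M a Γσ)
    (hdiag : Tendsto (fun p => ‖(M p).errorCov - dg (M p).errorCov‖) atTop (𝓝 0))
    (c c' : Fin kw) :
    NullInProb M fun p ω => (M p).meanPart (.inr c) (.inr c') ω - Ωw c c' * a := by
  have hlln := nullInProb_entry hcommon.lln_w c c' fun p => by
    simp only [Matrix.smul_apply, Matrix.sum_apply, Matrix.sub_apply, outer, Matrix.of_apply,
      smul_eq_mul]
    refine (Finset.measurable_sum _ fun s _ => Finset.measurable_sum _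
      fun t _ => ?_).const_mul _
    exact ((measurable_coord_w hcommon p s t _).mul
      (measurable_coord_w hcommon p s t _)).sub_const _
  have hb : Tendsto (fun p => ((1 / (p.2 : ℝ) ^ 2) • ∑ s, ∑ t ∈ Finset.Iio s,
      secondMoment (M p).P ((M p).w s t)) c c') atTop (𝓝 (Ωw c c')) :=
    ((continuous_apply_apply c c').tendsto Ωw).comp hcommon.tendsto_w
  have hX : NullInProb M fun p ω => 1 / (p.2 : ℝ) ^ 2 *
      (∑ s, ∑ t ∈ Finset.Iio s, (M p).w s t ω c * (M p).w s t ω c') -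
      ((1 / (p.2 : ℝ) ^ 2) • ∑ s, ∑ t ∈ Finset.Iio s,
        secondMoment (M p).P ((M p).w s t)) c c' := by
    refine hlln.mono (Eventually.of_forall fun p ω => le_of_eq ?_)
    congr 1
    simp only [Matrix.smul_apply, Matrix.sum_apply, Matrix.sub_apply, outer, Matrix.of_apply,
      Finset.sum_sub_distrib, smul_eq_mul, mul_sub]
  refine (hX.mul_sub_mul hb (tendsto_diag_sq hind hdiag)).mono
    (Eventually.of_forall fun p ω => le_of_eq ?_)
  rw [Model.meanPart]
  have hdom : compDom p.2 (.inr c : (Fin kγ × Fin kv) ⊕ Fin kw) ∩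
      compDom p.2 (.inr c' : (Fin kγ × Fin kv) ⊕ Fin kw) =
      compDom p.2 (.inr c : (Fin kγ × Fin kv) ⊕ Fin kw) := Finset.inter_self _
  rw [hdom, sum_compDom_inr]
  simp only [Model.compCoef, Model.compLoad, compOrder, compScale, one_mul]
  rw [div_mul_div_comm, one_mul, ← sq]

lemma inter_compDom_eq_empty {kγ kv kw : ℕ} (T : ℕ) (q : Fin kγ × Fin kv) (c : Fin kw) :
    compDom T (.inl q : (Fin kγ × Fin kv) ⊕ Fin kw) ∩
      compDom T (.inr c : (Fin kγ × Fin kv) ⊕ Fin kw) = ∅ := by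
  ext a
  simp only [compDom, Finset.mem_inter, Finset.mem_filter, Finset.mem_univ, true_and,
    Finset.notMem_empty, iff_false, not_and]
  intro h
  simp [h]

end MeanPart

lemma tendstoInProb_of_entries {kγ kv kw : ℕ} {M : PanelArray.{u} kγ kv kw} {ι : Type*} [Fintype ι]
    [DecidableEq ι] {X : ∀ p, (M p).Ω → Matrix ι ι ℝ} {L : Matrix ι ι ℝ}
    (h : ∀ i k, NullInProb M fun p ω => X p ω i k - L i k) : TendstoInProb M X L := by
  have h1 : NullInProb M fun p ω =>
      ∑ i, ∑ k, |X p ω i k - L i k| * ‖Matrix.single i k (1 : ℝ)‖ :=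
    NullInProb.sum _ fun i _ => NullInProb.sum _ fun k _ =>
      ((h i k).mono (X := fun p ω => |X p ω i k - L i k|)
        (Eventually.of_forall fun p ω => (abs_abs _).le)).mul_of_tendsto tendsto_const_nhds
  have h2 : NullInProb M fun p ω => ‖X p ω - L‖ := h1.mono (Eventually.of_forall fun p ω => by
    rw [abs_norm]
    exact (norm_le_sum_abs_entries (X p ω - L)).trans (le_abs_self _))
  intro ε hε
  simpa using h2 ε hε

end FactorPanel

theorem theorem3 {kγ kv kw : ℕ} (M : FactorPanel.PanelArray kγ kv kw)
    (Ωv : Matrix (Fin kv) (Fin kv) ℝ) (Ωw : Matrix (Fin kw) (Fin kw) ℝ)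
    (a : ℝ) (Γσ : Matrix (Fin kγ) (Fin kγ) ℝ)
    (hcommon : FactorPanel.CommonVars M Ωv Ωw)
    (hload : FactorPanel.Loadings M)
    (herr : FactorPanel.Errors M)
    (hind : FactorPanel.Independence M a Γσ)
    (hdiag : Tendsto (fun p => ‖(M p).errorCov - FactorPanel.dg (M p).errorCov‖) atTop (𝓝 0)) :
    FactorPanel.TendstoInProb M (fun p => (M p).varEstimator)
      (FactorPanel.sigmaXi a Γσ Ωv Ωw) := by
  refine FactorPanel.tendstoInProb_of_entries fun j j' => ?_
  have hdev := FactorPanel.nullInProb_sub_meanPart hcommon hload herr hind hdiag j j'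
  have hmean : FactorPanel.NullInProb M fun p ω =>
      (M p).meanPart j j' ω - FactorPanel.sigmaXi a Γσ Ωv Ωw j j' := by
    rcases j with q | c <;> rcases j' with q' | c'
    · simpa [FactorPanel.sigmaXi, mul_comm] using
        FactorPanel.nullInProb_meanPart_inl hcommon hload hind hdiag q q'
    · simpa [FactorPanel.sigmaXi, FactorPanel.Model.meanPart, FactorPanel.inter_compDom_eq_empty]
        using FactorPanel.NullInProb.of_tendsto (M := M) (y := fun _ => 0) tendsto_const_nhds
    · simpa [FactorPanel.sigmaXi, FactorPanel.Model.meanPart, Finset.inter_comm,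
        FactorPanel.inter_compDom_eq_empty]
        using FactorPanel.NullInProb.of_tendsto (M := M) (y := fun _ => 0) tendsto_const_nhds
    · simpa [FactorPanel.sigmaXi, mul_comm] using
        FactorPanel.nullInProb_meanPart_inr hcommon hind hdiag c c'
  simpa using hdev.add hmean
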